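/- Let $k$ be an algebraically closed field, let $0\le d\le n$ and $D\ge 1$ be integers, and let $\epsilon_0,\dots,\epsilon_d$ be the canonical basis of $\mathbb{N}^{d+1}$. Let $\mathcal{B}=\{\mathbf{b}_0,\dots,\mathbf{b}_n\}\subset\mathbb{N}^{d+1}$ be a set of $n+1$ distinct vectors $\mathbf{b}_l=(b_{l0},\dots,b_{ld})$ such that $\mathbf{b}_i=D\epsilon_i$ for $0\le i\le d$ and $b_{l0}+\dots+b_{ld}=D$ for $0\le l\le n$. Let $I_{\mathcal{B}}$ be the kernel of the $k$-algebra homomorphism $k[x_0,\dots,x_n]\to k[t_0,\dots,t_d]$, $x_l\mapsto t_0^{b_{l0}}\cdots t_d^{b_{ld}}$, and let $\mathcal{X}=V(I_{\mathcal{B}})\subset\mathbb{P}^n_k$ be the simplicial projective toric variety determined by $\mathcal{B}$. A point of $\mathcal{X}$ is singular if the local ring of $\mathcal{X}$ at that point is not regular. Let $P_i=(0:\dots:0:1:0:\dots:0)\in\mathbb{P}^n_k$, with the $1$ in position $i$, where positions are numbered from $0$. (1) If $\mathcal{X}$ has exactly one singular point, then that point is $P_i$ for some $i\in\{0,\dots,d\}$.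 (2) Assume that $\gcd\{b_{li} : 0\le l\le n,\ 0\le i\le d\}=1$. Then $P_0$ is the only singular point of $\mathcal{X}$ if and only if there is an integer $e\ge 1$ that divides $D$ and divides $b_{l0}$ for all $l\in\{0,\dots,n\}$, such that \[\{(D-1)\epsilon_i+\epsilon_j : 1\le i,j\le d\}\cup\{e\epsilon_0+(D-e)\epsilon_j : 1\le j\le d\}\subset\mathcal{B},\] and such that, if $e=1$, there is $j\in\{1,\dots,d\}$ with $(D-1)\epsilon_0+\epsilon_j\notin\mathcal{B}$. If $d\ge 2$, the "if" direction holds also without the assumption on the gcd. -/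

import Mathlib

namespace ToricSing

open MvPolynomial

noncomputable section

attribute [local instance] MvPolynomial.gradedAlgebra

/-- The toric ideal `I_B ⊆ k[x_0, …, x_n]` of the vectors `b_0, …, b_n ∈ ℕ^{d+1}`: the kernel of
`k[x_0, …, x_n] → k[t_0, …, t_d]`, `x_j ↦ t^{b_j}`. -/
def toricIdeal (k : Type*) [Field k] {n d : ℕ} (b : Fin (n + 1) → Fin (d + 1) → ℕ) :
    Ideal (MvPolynomial (Fin (n + 1)) k) :=
  RingHom.ker (aeval (fun j => ∏ l, (X l : MvPolynomial (Fin (d + 1)) k) ^ b j l) :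
    MvPolynomial (Fin (n + 1)) k →ₐ[k] MvPolynomial (Fin (d + 1)) k)

/-- The zero set `V(I) ⊆ ℙⁿ(k)` of a homogeneous ideal `I` (for such an ideal over an infinite field
the condition does not depend on the representative of `P`). -/
def zeroLocus {k : Type*} [Field k] {n : ℕ} (I : Ideal (MvPolynomial (Fin (n + 1)) k)) :
    Set (Projectivization k (Fin (n + 1) → k)) :=
  {P | ∀ f ∈ I, eval P.rep f = 0}

/-- The homogeneous prime ideal of a point `P = (p_0 : ⋯ : p_n)` of `ℙⁿ(k)`: the polynomials `f` with
`f (p_0 T, …, p_n T) = 0` in `k[T]`; it is generated by the forms vanishing at `P`. -/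
def pointIdeal {k : Type*} [Field k] {n : ℕ} (P : Projectivization k (Fin (n + 1) → k)) :
    Ideal (MvPolynomial (Fin (n + 1)) k) :=
  RingHom.ker (aeval (fun j => Polynomial.C (P.rep j) * Polynomial.X) :
    MvPolynomial (Fin (n + 1)) k →ₐ[k] Polynomial k)

instance pointIdeal_isPrime {k : Type*} [Field k] {n : ℕ}
    (P : Projectivization k (Fin (n + 1) → k)) : (pointIdeal P).IsPrime :=
  RingHom.ker_isPrime _

/-- The local ring of `ℙⁿ` at `P`: fractions `f / g` of forms of the same degree, `g(P) ≠ 0`. -/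
abbrev ProjLocalRing {k : Type*} [Field k] {n : ℕ} (P : Projectivization k (Fin (n + 1) → k)) :
    Type _ :=
  HomogeneousLocalization.AtPrime (homogeneousSubmodule (Fin (n + 1)) k) (pointIdeal P)

/-- The ideal of the closed subscheme defined by the homogeneous ideal `I` in the local ring of `ℙⁿ`
at `P`: the degree zero part of the extension of `I` to the localization at the prime of `P`. -/
def localIdeal {k : Type*} [Field k] {n : ℕ} (I : Ideal (MvPolynomial (Fin (n + 1)) k))
    (P : Projectivization k (Fin (n + 1) → k)) : Ideal (ProjLocalRing P) :=
  (I.map (algebraMap (MvPolynomial (Fin (n + 1)) k)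
    (Localization.AtPrime (pointIdeal P)))).comap
    (algebraMap (ProjLocalRing P) (Localization.AtPrime (pointIdeal P)))

/-- The local ring at `P` of the projective variety with homogeneous ideal `I`. -/
abbrev VarietyLocalRing {k : Type*} [Field k] {n : ℕ} (I : Ideal (MvPolynomial (Fin (n + 1)) k))
    (P : Projectivization k (Fin (n + 1) → k)) : Type _ :=
  ProjLocalRing P ⧸ localIdeal I P

/-- The set of singular points of the projective toric variety `X_B = V(I_B) ⊆ ℙⁿ(k)`: the points
of `X_B` at which the local ring of `X_B` is not regular. -/
def singularPoints (k : Type*) [Field k] {n d : ℕ} (b : Fin (n + 1) → Fin (d + 1) → ℕ) :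
    Set (Projectivization k (Fin (n + 1) → k)) :=
  {P | P ∈ zeroLocus (toricIdeal k b) ∧
    ¬ IsRegularLocalRing (VarietyLocalRing (toricIdeal k b) P)}

/-- The coordinate point `P_i = (0 : ⋯ : 0 : 1 : 0 : ⋯ : 0)` of `ℙⁿ(k)`. -/
def coordPoint (k : Type*) [Field k] {n : ℕ} (i : Fin (n + 1)) :
    Projectivization k (Fin (n + 1) → k) :=
  Projectivization.mk k (Pi.single i 1) (by simp)

/-- There is a divisor `e > 0` of `D`, dividing all `b_{i0}`, such that `B` contains all
`(D-1)ε_i + ε_j` and all `e ε_0 + (D-e) ε_j` for `i, j ∈ {1, …, d}` and, if `e = 1`, such that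
`(D-1)ε_0 + ε_j ∉ B` for some `j ∈ {1, …, d}`. -/
def OneSingularShape {n d : ℕ} (D : ℕ) (b : Fin (n + 1) → Fin (d + 1) → ℕ) : Prop :=
  ∃ e : ℕ, 0 < e ∧ e ∣ D ∧ (∀ l, e ∣ b l 0) ∧
    (∀ i j : Fin (d + 1), i ≠ 0 → j ≠ 0 →
      Pi.single i (D - 1) + Pi.single j 1 ∈ Set.range b) ∧
    (∀ j : Fin (d + 1), j ≠ 0 → Pi.single 0 e + Pi.single j (D - e) ∈ Set.range b) ∧
    (e = 1 → ∃ j : Fin (d + 1), j ≠ 0 ∧ Pi.single 0 (D - 1) + Pi.single j 1 ∉ Set.range b)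

end

end ToricSing

/-! The torus acts on `X` by rescaling coordinates and preserves the singular locus. The binomials
`x_l ^ D = ∏ x_i ^ b_li` show that a point of `X` has a nonzero vertex coordinate and, if it has
only one, is the corresponding `P_j`; a point with two of them is moved by the torus. So a unique
singular point is some `P_j`, and the charts `x_j ≠ 0`, `j ≤ d`, cover `X`.

The chart of the vertex `j` is the spectrum of the algebra of the semigroup `S_j` generated by the
`b_l` with coordinate `j` dropped. The key fact: `P_j` is regular iff `S_j` is generated by
multiples `c_i ε_i` of the basis vectors (`SmoothChart`). If so, the chart is an affine space and
all its points are regular (`SmoothChart.isRegularLocalRing`). Conversely, the local ring at `P_j`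
has dimension at most `d` (`ringKrullDim_varietyLocalRing_le`), while the irreducible elements of
`S_j` are independent modulo the square of the maximal ideal (`card_le_spanFinrank`). Regularity
thus leaves at most `d` irreducibles; each axis carries one, so there are no others
(`exists_single_of_card_irreducibleIn_le`).

Hence `P_0` is the only singular point iff the charts of all `j ≠ 0` are smooth and that of `0` is
not. What remains is divisibility arithmetic with the edge steps `c_i`. -/

namespace ToricSing

open MvPolynomial

noncomputable section

attribute [local instance] MvPolynomial.gradedAlgebra

/-! ### Monomial maps of polynomial rings -/

section MonomialMap

variable {k ι κ κ' : Type*} [Field k]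

/-- The homomorphism of polynomial rings `x_l ↦ t^{a_l}`. -/
def monomialMap (k : Type*) [Field k] (a : ι → κ →₀ ℕ) :
    MvPolynomial ι k →ₐ[k] MvPolynomial κ k :=
  aeval fun l => monomial (a l) 1

lemma monomialMap_X (a : ι → κ →₀ ℕ) (l : ι) :
    monomialMap k a (X l) = monomial (a l) 1 := by
  simp [monomialMap]

lemma monomialMap_monomial (a : ι → κ →₀ ℕ) (u : ι →₀ ℕ) (c : k) :
    monomialMap k a (monomial u c) = monomial (Finsupp.linearCombination ℕ a u) c := by
  rw [monomialMap, aeval_monomial, Finsupp.linearCombination_apply, Finsupp.prod, Finsupp.sum,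
    algebraMap_eq]
  simp only [monomial_pow, one_pow]
  rw [← monomial_sum_one, C_mul_monomial, mul_one]

lemma coeff_monomialMap [DecidableEq κ] (a : ι → κ →₀ ℕ) (f : MvPolynomial ι k) (w : κ →₀ ℕ) :
    coeff w (monomialMap k a f) =
      ∑ u ∈ f.support with Finsupp.linearCombination ℕ a u = w, coeff u f := by
  conv_lhs => rw [f.as_sum, map_sum, coeff_sum]
  simp only [monomialMap_monomial, coeff_monomial, Finset.sum_filter]

/-- The vanishing of the image of `f` depends only on which monomials of `f` have the same image. -/
lemma monomialMap_eq_zero_of_imp {a : ι → κ →₀ ℕ} {a' : ι → κ' →₀ ℕ} {f : MvPolynomial ι k}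
    (h : ∀ u ∈ f.support, ∀ v ∈ f.support,
      Finsupp.linearCombination ℕ a u = Finsupp.linearCombination ℕ a v ↔
      Finsupp.linearCombination ℕ a' u = Finsupp.linearCombination ℕ a' v)
    (hf : monomialMap k a f = 0) : monomialMap k a' f = 0 := by
  classical
  ext w
  rw [coeff_monomialMap, coeff_zero]
  by_cases hw : ∃ u ∈ f.support, Finsupp.linearCombination ℕ a' u = w
  · obtain ⟨u, hu, rfl⟩ := hw
    have := congrArg (coeff (Finsupp.linearCombination ℕ a u)) hf
    rw [coeff_monomialMap, coeff_zero] at this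
    rw [← this]
    refine Finset.sum_congr (Finset.filter_congr fun v hv => ?_) fun _ _ => rfl
    exact (h v hv u hu).symm
  · rw [Finset.filter_false_of_mem fun u hu h' => hw ⟨u, hu, h'⟩, Finset.sum_empty]

lemma monomialMap_eq_zero_iff {a : ι → κ →₀ ℕ} {a' : ι → κ' →₀ ℕ} {f : MvPolynomial ι k}
    (h : ∀ u ∈ f.support, ∀ v ∈ f.support,
      Finsupp.linearCombination ℕ a u = Finsupp.linearCombination ℕ a v ↔
      Finsupp.linearCombination ℕ a' u = Finsupp.linearCombination ℕ a' v) :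
    monomialMap k a f = 0 ↔ monomialMap k a' f = 0 :=
  ⟨monomialMap_eq_zero_of_imp h, monomialMap_eq_zero_of_imp fun u hu v hv => (h u hu v hv).symm⟩

lemma IsHomogeneous.aeval_mul_left {S : Type*} [CommRing S] [Algebra k S] {f : MvPolynomial ι k}
    {N : ℕ} (hf : f.IsHomogeneous N) (t : S) (g : ι → S) :
    aeval (fun l => t * g l) f = t ^ N * aeval g f := by
  simp only [aeval_def, eval₂_eq, Finset.mul_sum]
  refine Finset.sum_congr rfl fun u hu => ?_
  have hN : ∑ i ∈ u.support, u i = N := (hf.degree_eq_sum_deg_support hu).symm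
  simp only [mul_pow, Finset.prod_mul_distrib]
  rw [Finset.prod_pow_eq_pow_sum, hN]
  ring

end MonomialMap

/-! ### Local rings of projective space and of subvarieties -/

section LocalRing

variable {k : Type*} [Field k] {n : ℕ}

lemma toricIdeal_eq_ker {d : ℕ} (b : Fin (n + 1) → Fin (d + 1) → ℕ) :
    toricIdeal k b = RingHom.ker (monomialMap k fun l => Finsupp.equivFunOnFinite.symm (b l)) := by
  have : (fun j => ∏ l, (X l : MvPolynomial (Fin (d + 1)) k) ^ b j l) =
      fun l => monomial (Finsupp.equivFunOnFinite.symm (b l)) 1 := by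
    funext l
    rw [monomial_eq, Finsupp.prod_fintype _ _ (by simp)]
    simp
  rw [toricIdeal, this, monomialMap]

lemma toricIdeal_isPrime {d : ℕ} (b : Fin (n + 1) → Fin (d + 1) → ℕ) :
    (toricIdeal k b).IsPrime :=
  RingHom.ker_isPrime _

variable {P : Projectivization k (Fin (n + 1) → k)} {I : Ideal (MvPolynomial (Fin (n + 1)) k)}

lemma mem_pointIdeal_iff {f : MvPolynomial (Fin (n + 1)) k} {N : ℕ} (hf : f.IsHomogeneous N) :
    f ∈ pointIdeal P ↔ eval P.rep f = 0 := by
  rw [pointIdeal, RingHom.mem_ker]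
  simp only [mul_comm (Polynomial.C _)]
  rw [IsHomogeneous.aeval_mul_left hf]
  have : aeval (fun l => Polynomial.C (P.rep l)) f = Polynomial.C (eval P.rep f) := by
    rw [← coe_aeval_eq_eval, RingHom.coe_coe]
    exact (aeval_algebraMap_apply (Polynomial k) P.rep f)
  rw [this]
  simp [mul_eq_zero]

lemma eval_rep_eq_zero_of_mem_pointIdeal {f : MvPolynomial (Fin (n + 1)) k}
    (hf : f ∈ pointIdeal P) : eval P.rep f = 0 := by
  rw [pointIdeal, RingHom.mem_ker] at hf
  have := congrArg (Polynomial.aeval (1 : k)) hf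
  rw [← AlgHom.comp_apply, comp_aeval] at this
  simpa [aeval_eq_eval] using this

/-- A fraction of forms of the same degree, as an element of the local ring of `ℙⁿ` at `P`. -/
def frac {N : ℕ} (f g : MvPolynomial (Fin (n + 1)) k) (hf : f.IsHomogeneous N)
    (hg : g.IsHomogeneous N) (hgP : g ∉ pointIdeal P) : ProjLocalRing P :=
  HomogeneousLocalization.mk ⟨N, ⟨f, hf⟩, ⟨g, hg⟩, hgP⟩

lemma val_frac {N : ℕ} {f g : MvPolynomial (Fin (n + 1)) k} (hf : f.IsHomogeneous N)
    (hg : g.IsHomogeneous N) (hgP : g ∉ pointIdeal P) :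
    (frac f g hf hg hgP).val = Localization.mk f ⟨g, hgP⟩ := rfl

lemma exists_eq_frac (z : ProjLocalRing P) : ∃ (N : ℕ) (f g : MvPolynomial (Fin (n + 1)) k)
    (hf : f.IsHomogeneous N) (hg : g.IsHomogeneous N) (hgP : g ∉ pointIdeal P),
    z = frac f g hf hg hgP := by
  obtain ⟨⟨N, ⟨f, hf⟩, ⟨g, hg⟩, h⟩, rfl⟩ := HomogeneousLocalization.mk_surjective z
  exact ⟨N, f, g, hf, hg, h, rfl⟩

/-- The multipliers allowed in the localization lie outside the point ideal, hence outside `I`, and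
`I` is prime; so extending and contracting `I` adds no new forms. -/
lemma frac_mem_localIdeal_iff (hI : I.IsPrime) (hIP : I ≤ pointIdeal P) {N : ℕ}
    {f g : MvPolynomial (Fin (n + 1)) k} (hf : f.IsHomogeneous N)
    (hg : g.IsHomogeneous N) (hgP : g ∉ pointIdeal P) :
    frac f g hf hg hgP ∈ localIdeal I P ↔ f ∈ I := by
  rw [localIdeal, Ideal.mem_comap, HomogeneousLocalization.algebraMap_apply, val_frac,
    Localization.mk_eq_mk', IsLocalization.mk'_mem_map_algebraMap_iff]
  constructor
  · rintro ⟨s, hs, h⟩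
    exact (hI.mem_or_mem h).resolve_left fun h' => hs (hIP h')
  · exact fun h => ⟨1, one_mem _, by simpa using h⟩

section Lift

variable {R : Type*} [CommRing R] (φ : MvPolynomial (Fin (n + 1)) k →+* R)
  (hφ : ∀ (N : ℕ) (g : MvPolynomial (Fin (n + 1)) k), g.IsHomogeneous N → g ∉ pointIdeal P →
    IsUnit (φ g))

/-- The function underlying `projLift`. -/
def projLiftFun : ProjLocalRing P → R :=
  Quotient.lift (fun c => φ c.num * ↑(hφ c.deg c.den c.den.2 c.den_mem).unit⁻¹) (by
    intro c c' h
    have h' : Localization.mk (c.num : MvPolynomial (Fin (n + 1)) k)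
        (⟨c.den, c.den_mem⟩ : (pointIdeal P).primeCompl) =
        Localization.mk (c'.num : MvPolynomial (Fin (n + 1)) k) ⟨c'.den, c'.den_mem⟩ := h
    rw [Localization.mk_eq_mk_iff, Localization.r_iff_exists] at h'
    obtain ⟨s, hs⟩ := h'
    -- The factor `s` need not be homogeneous, so `φ s` need not be a unit; `s` is cancelled in the
    -- polynomial domain before `φ` is applied.
    have hs0 : (s : MvPolynomial (Fin (n + 1)) k) ≠ 0 := fun h0 =>
      s.2 (h0 ▸ zero_mem _)
    have := congrArg φ (mul_left_cancel₀ hs0 hs)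
    simp only [map_mul] at this
    rw [Units.mul_inv_eq_iff_eq_mul, mul_right_comm, Units.eq_mul_inv_iff_mul_eq]
    simp only [IsUnit.unit_spec]
    linear_combination this)

lemma projLiftFun_mk_mul (c : HomogeneousLocalization.NumDenSameDeg
    (homogeneousSubmodule (Fin (n + 1)) k) (pointIdeal P).primeCompl) :
    projLiftFun φ hφ (HomogeneousLocalization.mk c) * φ c.den = φ c.num := by
  change (φ c.num * ↑(hφ _ c.den c.den.2 c.den_mem).unit⁻¹) * φ c.den = φ c.num
  rw [mul_assoc, IsUnit.val_inv_mul, mul_one]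

/-- A homomorphism on polynomials which makes the forms that do not vanish at `P` invertible
extends to the local ring of `ℙⁿ` at `P`. -/
def projLift : ProjLocalRing P →+* R where
  toFun := projLiftFun φ hφ
  map_one' := by
    have := projLiftFun_mk_mul φ hφ (P := P) 1
    simpa using this
  map_mul' z w := by
    obtain ⟨c, rfl⟩ := HomogeneousLocalization.mk_surjective z
    obtain ⟨c', rfl⟩ := HomogeneousLocalization.mk_surjective w
    rw [← HomogeneousLocalization.mk_mul]
    apply ((hφ _ c.den c.den.2 c.den_mem).mul (hφ _ c'.den c'.den.2 c'.den_mem)).mul_right_cancel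
    have h := projLiftFun_mk_mul φ hφ (c * c')
    have h1 := projLiftFun_mk_mul φ hφ c
    have h2 := projLiftFun_mk_mul φ hφ c'
    simp only [HomogeneousLocalization.NumDenSameDeg.num_mul,
      HomogeneousLocalization.NumDenSameDeg.den_mul, map_mul] at h
    rw [h, ← h1, ← h2]
    ring
  map_zero' := by
    have := projLiftFun_mk_mul φ hφ (P := P) 0
    simpa using this
  map_add' z w := by
    obtain ⟨c, rfl⟩ := HomogeneousLocalization.mk_surjective z
    obtain ⟨c', rfl⟩ := HomogeneousLocalization.mk_surjective w
    rw [← HomogeneousLocalization.mk_add]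
    apply ((hφ _ c.den c.den.2 c.den_mem).mul (hφ _ c'.den c'.den.2 c'.den_mem)).mul_right_cancel
    have h := projLiftFun_mk_mul φ hφ (c + c')
    have h1 := projLiftFun_mk_mul φ hφ c
    have h2 := projLiftFun_mk_mul φ hφ c'
    simp only [HomogeneousLocalization.NumDenSameDeg.num_add,
      HomogeneousLocalization.NumDenSameDeg.den_add, map_mul, map_add] at h
    rw [h, ← h1, ← h2]
    ring

lemma projLift_frac_mul {N : ℕ} {f g : MvPolynomial (Fin (n + 1)) k} (hf : f.IsHomogeneous N)
    (hg : g.IsHomogeneous N) (hgP : g ∉ pointIdeal P) :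
    projLift φ hφ (frac f g hf hg hgP) * φ g = φ f :=
  projLiftFun_mk_mul φ hφ ⟨N, ⟨f, hf⟩, ⟨g, hg⟩, hgP⟩

end Lift

end LocalRing

/-! ### Regularity on affine-space charts and under rescaling -/

section Chart

variable {k : Type*} [Field k] {n : ℕ} {P : Projectivization k (Fin (n + 1) → k)}
  {I : Ideal (MvPolynomial (Fin (n + 1)) k)}

/-- A surjection from the local ring of `ℙⁿ` whose kernel is the ideal of the variety identifies
the local ring of the variety. -/
def varietyLocalRingEquiv {R : Type*} [CommRing R] (Φ : ProjLocalRing P →+* R)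
    (hΦ : Function.Surjective Φ) (hker : RingHom.ker Φ = localIdeal I P) :
    VarietyLocalRing I P ≃+* R :=
  (Ideal.quotEquivOfEq hker.symm).trans (RingHom.quotientKerEquivOfSurjective hΦ)

/-- If a dehomogenization identifies an affine chart of the variety with an affine space, then the
local rings at the points of this chart are regular. -/
theorem isRegularLocalRing_of_dehomogenization {σ : Type*} [Finite σ] (hI : I.IsPrime)
    (hIP : I ≤ pointIdeal P) (δ : MvPolynomial (Fin (n + 1)) k →ₐ[k] MvPolynomial σ k)
    (hδ : ∀ (N : ℕ) (f : MvPolynomial (Fin (n + 1)) k), f.IsHomogeneous N → (δ f = 0 ↔ f ∈ I))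
    {J : Fin (n + 1)} (hJ : δ (X J) = 1) (hP : P.rep J ≠ 0) (l : σ → Fin (n + 1))
    (hl : ∀ i, δ (X (l i)) = X i) : IsRegularLocalRing (VarietyLocalRing I P) := by
  let a : σ → k := fun i => P.rep (l i) / P.rep J
  -- Every polynomial on the chart is the dehomogenization of a form with the matching value at `P`.
  have lift : ∀ q : MvPolynomial σ k, ∃ (M : ℕ) (h : MvPolynomial (Fin (n + 1)) k),
      h.IsHomogeneous M ∧ δ h = q ∧ eval P.rep h = P.rep J ^ M * eval a q := by
    intro q
    induction q using MvPolynomial.induction_on with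
    | C c =>
      exact ⟨0, C c, isHomogeneous_C _ _, by rw [← algebraMap_eq, AlgHom.commutes]; rfl,
        by simp⟩
    | add p q hp hq =>
      obtain ⟨M, h, hh, hp, hpe⟩ := hp
      obtain ⟨M', h', hh', hq, hqe⟩ := hq
      refine ⟨M + M', h * X J ^ M' + h' * X J ^ M, ?_, by simp [hp, hq, hJ], ?_⟩
      · have h2 := hh'.mul (isHomogeneous_X_pow (R := k) J M)
        rw [add_comm M' M] at h2
        exact (hh.mul (isHomogeneous_X_pow J M')).add h2
      · simp only [map_add, map_mul, map_pow, eval_X, hpe, hqe]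
        ring
    | mul_X p i hp =>
      obtain ⟨M, h, hh, hp, hpe⟩ := hp
      refine ⟨M + 1, h * X (l i), hh.mul (isHomogeneous_X _ _), by simp [hp, hl], ?_⟩
      simp only [map_mul, eval_X, hpe, a]
      field_simp
      ring
  -- After multiplication by powers of `X J`, `f` and the lift of `δ f` are forms of the same degree
  -- with the same image under `δ`; their difference lies in `I` and so vanishes at `P`.
  have heval : ∀ (N : ℕ) (f : MvPolynomial (Fin (n + 1)) k), f.IsHomogeneous N →
      eval P.rep f = P.rep J ^ N * eval a (δ f) := by
    intro N f hf
    obtain ⟨M, h, hh, hδh, he⟩ := lift (δ f)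
    have h1 := hf.mul (isHomogeneous_X_pow (R := k) J M)
    have h2 := hh.mul (isHomogeneous_X_pow (R := k) J N)
    rw [add_comm M] at h2
    have hmem : f * X J ^ M - h * X J ^ N ∈ I :=
      (hδ _ _ (h1.sub h2)).1 (by simp [hδh, hJ])
    have h0 := eval_rep_eq_zero_of_mem_pointIdeal (hIP hmem)
    simp only [map_sub, map_mul, map_pow, eval_X, he] at h0
    have hM : P.rep J ^ M ≠ 0 := pow_ne_zero _ hP
    apply mul_right_cancel₀ hM
    linear_combination h0
  let 𝔪 : Ideal (MvPolynomial σ k) := RingHom.ker (eval a)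
  have h𝔪 : 𝔪.IsPrime := RingHom.ker_isPrime _
  have hmem : ∀ (N : ℕ) (f : MvPolynomial (Fin (n + 1)) k), f.IsHomogeneous N →
      (δ f ∈ 𝔪 ↔ f ∈ pointIdeal P) := by
    intro N f hf
    rw [mem_pointIdeal_iff hf, heval N f hf, RingHom.mem_ker, mul_eq_zero,
      or_iff_right (pow_ne_zero _ hP)]
  let φ : MvPolynomial (Fin (n + 1)) k →+* Localization.AtPrime 𝔪 :=
    (algebraMap _ (Localization.AtPrime 𝔪)).comp (δ : MvPolynomial (Fin (n + 1)) k →+* MvPolynomial σ k)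
  have hφ : ∀ (N : ℕ) (g : MvPolynomial (Fin (n + 1)) k), g.IsHomogeneous N →
      g ∉ pointIdeal P → IsUnit (φ g) := fun N g hg hgP =>
    IsLocalization.map_units (M := 𝔪.primeCompl) (Localization.AtPrime 𝔪)
      ⟨δ g, fun h => hgP ((hmem N g hg).1 h)⟩
  have hinj : Function.Injective (algebraMap (MvPolynomial σ k) (Localization.AtPrime 𝔪)) :=
    IsLocalization.injective _ 𝔪.primeCompl_le_nonZeroDivisors
  have hsurj : Function.Surjective (projLift φ hφ) := by
    intro z
    obtain ⟨p, ⟨q, hq⟩, rfl⟩ := IsLocalization.exists_mk'_eq 𝔪.primeCompl z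
    obtain ⟨M, f, hf, rfl, -⟩ := lift p
    obtain ⟨M', g, hg, rfl, -⟩ := lift q
    have h1 := hf.mul (isHomogeneous_X_pow (R := k) J M')
    have h2 := hg.mul (isHomogeneous_X_pow (R := k) J M)
    rw [add_comm M'] at h2
    have hg2 : g * X J ^ M ∉ pointIdeal P := by
      rw [← hmem _ _ h2]
      simpa [hJ] using hq
    refine ⟨frac _ _ h1 h2 hg2, ?_⟩
    rw [IsLocalization.eq_mk'_iff_mul_eq]
    have := projLift_frac_mul φ hφ h1 h2 hg2
    simpa [φ, hJ] using this
  have hker : RingHom.ker (projLift φ hφ) = localIdeal I P := by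
    ext z
    obtain ⟨N, f, g, hf, hg, hgP, rfl⟩ := exists_eq_frac z
    rw [frac_mem_localIdeal_iff hI hIP, ← hδ N f hf, RingHom.mem_ker,
      ← (hφ N g hg hgP).mul_left_eq_zero, projLift_frac_mul]
    exact map_eq_zero_iff _ hinj
  exact IsRegularLocalRing.of_ringEquiv (varietyLocalRingEquiv _ hsurj hker).symm

/-- Local rings at points exchanged by a rescaling of the coordinates preserving the ideal. -/
theorem isRegularLocalRing_of_rescaling (hI : I.IsPrime) {Q : Projectivization k (Fin (n + 1) → k)}
    (hIP : I ≤ pointIdeal P) (hIQ : I ≤ pointIdeal Q) (s : Fin (n + 1) → kˣ)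
    (hsI : ∀ f, aeval (fun l => C (s l : k) * X l) f ∈ I ↔ f ∈ I)
    (hPQ : ∀ f, aeval (fun l => C (s l : k) * X l) f ∈ pointIdeal P ↔ f ∈ pointIdeal Q)
    (h : IsRegularLocalRing (VarietyLocalRing I P)) :
    IsRegularLocalRing (VarietyLocalRing I Q) := by
  let τ : MvPolynomial (Fin (n + 1)) k →ₐ[k] MvPolynomial (Fin (n + 1)) k :=
    aeval fun l => C (s l : k) * X l
  let τ' : MvPolynomial (Fin (n + 1)) k →ₐ[k] MvPolynomial (Fin (n + 1)) k :=
    aeval fun l => C ((s l)⁻¹ : k) * X l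
  have hττ' : ∀ f, τ (τ' f) = f := by
    intro f
    rw [← AlgHom.comp_apply]
    conv_rhs => rw [← AlgHom.id_apply (R := k) f]
    congr 1
    ext l : 1
    have h1 : τ' (X l) = C ((s l)⁻¹ : k) * X l := aeval_X _ _
    have h2 : τ (X l) = C (s l : k) * X l := aeval_X _ _
    rw [AlgHom.comp_apply, h1, map_mul, h2, ← algebraMap_eq, AlgHom.commutes, algebraMap_eq,
      ← mul_assoc, ← C_mul]
    simp
  have hhom : ∀ (c : Fin (n + 1) → k) (N : ℕ) (f : MvPolynomial (Fin (n + 1)) k),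
      f.IsHomogeneous N → (aeval (fun l => C (c l) * X l) f :
        MvPolynomial (Fin (n + 1)) k).IsHomogeneous N := by
    intro c N f hf
    simpa using hf.aeval (fun l => C (c l) * X l) (n := 1) fun l => isHomogeneous_C_mul_X _ _
  let g : homogeneousSubmodule (Fin (n + 1)) k →+*ᵍ homogeneousSubmodule (Fin (n + 1)) k :=
    { (τ : MvPolynomial (Fin (n + 1)) k →+* _) with map_mem := fun {N} {f} hf => hhom _ N f hf }
  let Φ : ProjLocalRing Q →+* VarietyLocalRing I P := (Ideal.Quotient.mk (localIdeal I P)).comp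
    (HomogeneousLocalization.map g (P := (pointIdeal Q).primeCompl)
      (Q := (pointIdeal P).primeCompl) fun f hf h => hf ((hPQ f).1 h))
  have hΦ : ∀ {N : ℕ} {f g : MvPolynomial (Fin (n + 1)) k} (hf : f.IsHomogeneous N)
      (hg : g.IsHomogeneous N) (hgP : g ∉ pointIdeal Q),
      Φ (frac f g hf hg hgP) = Ideal.Quotient.mk (localIdeal I P) (frac (τ f) (τ g)
        (hhom _ N f hf) (hhom _ N g hg) fun h => hgP ((hPQ g).1 h)) := fun _ _ _ => rfl
  have hsurj : Function.Surjective Φ := by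
    intro z
    obtain ⟨z, rfl⟩ := Ideal.Quotient.mk_surjective z
    obtain ⟨N, f, g, hf, hg, hgP, rfl⟩ := exists_eq_frac z
    refine ⟨frac (τ' f) (τ' g) (hhom _ N f hf) (hhom _ N g hg) fun h => hgP ?_, ?_⟩
    · rw [← hττ' g]
      exact (hPQ _).2 h
    · rw [hΦ]
      simp only [hττ']
  have hker : RingHom.ker Φ = localIdeal I Q := by
    ext z
    obtain ⟨N, f, g, hf, hg, hgP, rfl⟩ := exists_eq_frac z
    rw [frac_mem_localIdeal_iff hI hIQ, RingHom.mem_ker, hΦ, Ideal.Quotient.eq_zero_iff_mem,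
      frac_mem_localIdeal_iff hI hIP]
    exact hsI f
  exact IsRegularLocalRing.of_ringEquiv (varietyLocalRingEquiv Φ hsurj hker).symm

end Chart

/-! ### Points of the toric variety and the torus action -/

section Points

variable {k : Type*} [Field k] {n : ℕ}

/-- Changing the representative by a unit `c` amounts to the substitution `T ↦ c T` in `k[T]`. -/
lemma mem_pointIdeal_mk_iff {v : Fin (n + 1) → k} (hv : v ≠ 0)
    (f : MvPolynomial (Fin (n + 1)) k) :
    f ∈ pointIdeal (Projectivization.mk k v hv) ↔
      aeval (fun l => Polynomial.C (v l) * Polynomial.X) f = 0 := by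
  obtain ⟨a, ha⟩ := Projectivization.exists_smul_eq_mk_rep k v hv
  rw [pointIdeal, RingHom.mem_ker, ← ha]
  have key : ∀ (c : kˣ) (w : Fin (n + 1) → k),
      aeval (fun l => Polynomial.C (w l) * Polynomial.X) f = 0 →
      aeval (fun l => Polynomial.C ((c • w) l) * Polynomial.X) f = 0 := by
    intro c w h
    have := congrArg (Polynomial.aeval (Polynomial.C (c : k) * Polynomial.X)) h
    rw [← AlgHom.comp_apply, comp_aeval, map_zero] at this
    rw [← this]
    congr 2
    funext l
    simp [Units.smul_def, Polynomial.algebraMap_eq]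
    ring
  refine ⟨fun h => ?_, key a v⟩
  have := key a⁻¹ (a • v) h
  rwa [inv_smul_smul] at this

lemma mem_zeroLocus_of_le_pointIdeal {I : Ideal (MvPolynomial (Fin (n + 1)) k)}
    {P : Projectivization k (Fin (n + 1) → k)} (h : I ≤ pointIdeal P) : P ∈ zeroLocus I :=
  fun _ hf => eval_rep_eq_zero_of_mem_pointIdeal (h hf)

lemma eq_coordPoint {P : Projectivization k (Fin (n + 1) → k)} {J : Fin (n + 1)}
    (h : ∀ l, l ≠ J → P.rep l = 0) : P = coordPoint k J := by
  rw [← P.mk_rep, coordPoint, Projectivization.mk_eq_mk_iff']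
  refine ⟨P.rep J, ?_⟩
  funext l
  by_cases hl : l = J
  · subst hl; simp
  · simp [hl, h l hl]

variable {d D : ℕ} {b : Fin (n + 1) → Fin (d + 1) → ℕ}

/-- The substitution `t_i ↦ t i * t_i` in the target of the toric map induces this rescaling of the
source. Zero entries of `t` are allowed, which the next use with an arbitrary scalar needs. -/
lemma rescale_mem_toricIdeal (t : Fin (d + 1) → k) {f : MvPolynomial (Fin (n + 1)) k}
    (hf : f ∈ toricIdeal k b) :
    aeval (fun l => C (∏ i, t i ^ b l i) * X l) f ∈ toricIdeal k b := by
  rw [toricIdeal, RingHom.mem_ker] at hf ⊢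
  have := congrArg (aeval (fun i => C (t i) * X i : Fin (d + 1) → MvPolynomial (Fin (d + 1)) k)) hf
  rw [← AlgHom.comp_apply, comp_aeval, map_zero] at this
  rw [← AlgHom.comp_apply, comp_aeval, ← this]
  congr 2
  funext l
  rw [map_mul, aeval_X, ← algebraMap_eq, AlgHom.commutes]
  simp [mul_pow, Finset.prod_mul_distrib, algebraMap_eq]

lemma rescale_mem_toricIdeal_iff (t : Fin (d + 1) → kˣ) (f : MvPolynomial (Fin (n + 1)) k) :
    aeval (fun l => C (∏ i, (t i : k) ^ b l i) * X l) f ∈ toricIdeal k b ↔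
      f ∈ toricIdeal k b := by
  refine ⟨fun h => ?_, rescale_mem_toricIdeal _⟩
  have := rescale_mem_toricIdeal (fun i => ((t i)⁻¹ : k)) h
  rw [← AlgHom.comp_apply, comp_aeval] at this
  convert this
  conv_lhs => rw [← aeval_X_left_apply f]
  congr 2
  funext l
  rw [map_mul, aeval_X, ← algebraMap_eq, AlgHom.commutes, algebraMap_eq, ← mul_assoc, ← C_mul,
    ← Finset.prod_mul_distrib]
  simp

/-- This is the homogeneity of the toric ideal: for `x = μ ^ D`, acting by the constant vector `μ`
multiplies every coordinate by `x`. So `f (x P) = 0` for all `x` in the infinite field `k`, and the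
polynomial `f (P T)` is zero. -/
lemma toricIdeal_le_pointIdeal [IsAlgClosed k] (hD : 0 < D) (hdeg : ∀ l, ∑ i, b l i = D)
    {P : Projectivization k (Fin (n + 1) → k)} (hP : P ∈ zeroLocus (toricIdeal k b)) :
    toricIdeal k b ≤ pointIdeal P := by
  intro f hf
  have := IsAlgClosed.instInfinite (K := k)
  rw [pointIdeal, RingHom.mem_ker]
  apply Polynomial.eq_zero_of_infinite_isRoot
  refine Set.Infinite.mono ?_ (Set.infinite_univ (α := k))
  intro x _
  obtain ⟨μ, rfl⟩ := IsAlgClosed.exists_pow_nat_eq x hD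
  have h := hP _ (rescale_mem_toricIdeal (fun _ => μ) hf)
  rw [Set.mem_ofPred_eq, Polynomial.IsRoot.def, ← h, ← Polynomial.coe_aeval_eq_eval,
    ← AlgHom.comp_apply, comp_aeval, ← coe_aeval_eq_eval, RingHom.coe_coe,
    ← AlgHom.comp_apply, comp_aeval]
  congr 2
  funext l
  rw [Finset.prod_pow_eq_pow_sum, hdeg]
  simp only [map_mul, aeval_X, aeval_C, Polynomial.aeval_C, Polynomial.aeval_X]
  exact mul_comm _ _

variable (hdn : d + 1 ≤ n + 1)

lemma exists_ne_zero_of_ne_castLE (hinj : Function.Injective b)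
    (hvert : ∀ i : Fin (d + 1), b (Fin.castLE hdn i) = Pi.single i D)
    (hdeg : ∀ l, ∑ i, b l i = D) {j : Fin (d + 1)} {l : Fin (n + 1)}
    (hl : l ≠ Fin.castLE hdn j) : ∃ i, i ≠ j ∧ b l i ≠ 0 := by
  by_contra! h
  refine hl (hinj ?_)
  rw [hvert]
  funext i
  by_cases hi : i = j
  · subst hi
    rw [Pi.single_eq_same, ← hdeg l, Finset.sum_eq_single i (fun x _ hx => h x hx) (by simp)]
  · rw [h i hi, Pi.single_eq_of_ne hi]

lemma coordPoint_mem_zeroLocus [IsAlgClosed k] (hD : 0 < D) (hinj : Function.Injective b)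
    (hvert : ∀ i : Fin (d + 1), b (Fin.castLE hdn i) = Pi.single i D)
    (hdeg : ∀ l, ∑ i, b l i = D) (j : Fin (d + 1)) :
    coordPoint k (Fin.castLE hdn j) ∈ zeroLocus (toricIdeal k b) := by
  intro f hf
  obtain ⟨a, ha⟩ := Projectivization.exists_smul_eq_mk_rep k
    (Pi.single (Fin.castLE hdn j) 1 : Fin (n + 1) → k) (by simp)
  rw [coordPoint, ← ha]
  -- The representative `a e_J` is the image of `μ ε_j` under the monomial parametrization: every `b
  -- l` with `l ≠ J` involves a coordinate other than `j`.
  obtain ⟨μ, hμ⟩ := IsAlgClosed.exists_pow_nat_eq (a : k) hD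
  rw [toricIdeal, RingHom.mem_ker] at hf
  have h := congrArg (aeval (Pi.single j μ : Fin (d + 1) → k)) hf
  rw [← AlgHom.comp_apply, comp_aeval, map_zero] at h
  rw [← h, ← coe_aeval_eq_eval, RingHom.coe_coe]
  congr 2
  funext l
  by_cases hl : l = Fin.castLE hdn j
  · subst hl
    rw [hvert, map_prod, Finset.prod_eq_single j]
    · simp [hμ, Units.smul_def]
    · intro i _ hi
      simp [hi]
    · simp
  · obtain ⟨i, hij, hi⟩ := exists_ne_zero_of_ne_castLE hdn hinj hvert hdeg hl
    rw [map_prod, Finset.prod_eq_zero (Finset.mem_univ i)]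
    · simp [hl]
    · simp [hij, hi]

/-- Both monomials map to `t ^ (D b_l)`. Through this relation the vertex coordinates control the
vanishing of all the others. -/
lemma X_pow_sub_prod_mem_toricIdeal
    (hvert : ∀ i : Fin (d + 1), b (Fin.castLE hdn i) = Pi.single i D) (l : Fin (n + 1)) :
    (X l ^ D - ∏ i, X (Fin.castLE hdn i) ^ b l i : MvPolynomial (Fin (n + 1)) k) ∈
      toricIdeal k b := by
  rw [toricIdeal, RingHom.mem_ker]
  have h1 : ∀ i : Fin (d + 1), (∏ x, (X x : MvPolynomial (Fin (d + 1)) k) ^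
      (Pi.single i D : Fin (d + 1) → ℕ) x) = X i ^ D := by
    intro i
    rw [Finset.prod_eq_single i]
    · simp
    · intro x _ hx; simp [hx]
    · simp
  simp only [map_sub, map_pow, map_prod, aeval_X, hvert, h1]
  rw [← Finset.prod_pow, sub_eq_zero]
  exact Finset.prod_congr rfl fun i _ => pow_right_comm _ _ _

lemma isHomogeneous_X_pow_sub_prod (hdeg : ∀ l, ∑ i, b l i = D) (l : Fin (n + 1)) :
    (X l ^ D - ∏ i, X (Fin.castLE hdn i) ^ b l i :
      MvPolynomial (Fin (n + 1)) k).IsHomogeneous D := by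
  have h := IsHomogeneous.prod Finset.univ
    (fun i => (X (Fin.castLE hdn i) ^ b l i : MvPolynomial (Fin (n + 1)) k)) (b l)
    fun i _ => isHomogeneous_X_pow _ _
  rw [hdeg l] at h
  exact (isHomogeneous_X_pow l D).sub h

lemma rep_pow_eq (hvert : ∀ i : Fin (d + 1), b (Fin.castLE hdn i) = Pi.single i D)
    {P : Projectivization k (Fin (n + 1) → k)}
    (hP : P ∈ zeroLocus (toricIdeal k b)) (l : Fin (n + 1)) :
    P.rep l ^ D = ∏ i, P.rep (Fin.castLE hdn i) ^ b l i := by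
  have := hP _ (X_pow_sub_prod_mem_toricIdeal hdn hvert l)
  simpa [sub_eq_zero, eval_prod] using this

lemma exists_rep_castLE_ne_zero (hD : 0 < D) (hdeg : ∀ l, ∑ i, b l i = D)
    (hvert : ∀ i : Fin (d + 1), b (Fin.castLE hdn i) = Pi.single i D)
    {P : Projectivization k (Fin (n + 1) → k)} (hP : P ∈ zeroLocus (toricIdeal k b)) :
    ∃ i, P.rep (Fin.castLE hdn i) ≠ 0 := by
  by_contra! h
  refine P.rep_nonzero (funext fun l => ?_)
  refine (pow_eq_zero_iff hD.ne').1 ?_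
  obtain ⟨i, -, hi⟩ := Finset.exists_ne_zero_of_sum_ne_zero (by rw [hdeg l]; exact hD.ne')
  rw [rep_pow_eq hdn hvert hP l]
  exact Finset.prod_eq_zero (Finset.mem_univ i) (by rw [h i, zero_pow hi])

lemma eq_coordPoint_of_mem_zeroLocus (hD : 0 < D) (hinj : Function.Injective b)
    (hvert : ∀ i : Fin (d + 1), b (Fin.castLE hdn i) = Pi.single i D)
    (hdeg : ∀ l, ∑ i, b l i = D) {P : Projectivization k (Fin (n + 1) → k)}
    (hP : P ∈ zeroLocus (toricIdeal k b)) {j : Fin (d + 1)}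
    (h : ∀ i, i ≠ j → P.rep (Fin.castLE hdn i) = 0) :
    P = coordPoint k (Fin.castLE hdn j) := by
  refine eq_coordPoint fun l hl => ?_
  obtain ⟨i, hij, hi⟩ := exists_ne_zero_of_ne_castLE hdn hinj hvert hdeg hl
  refine (pow_eq_zero_iff hD.ne').1 ?_
  rw [rep_pow_eq hdn hvert hP l]
  exact Finset.prod_eq_zero (Finset.mem_univ i) (by rw [h i hij, zero_pow hi])

/-- The singular locus is stable under the action of the torus, so a unique singular point is one
of the fixed points of the torus. -/
theorem exists_eq_coordPoint_of_singularPoints_eq_singleton [IsAlgClosed k] (hD : 0 < D)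
    (hinj : Function.Injective b)
    (hvert : ∀ i : Fin (d + 1), b (Fin.castLE hdn i) = Pi.single i D)
    (hdeg : ∀ l, ∑ i, b l i = D) {P : Projectivization k (Fin (n + 1) → k)}
    (hP : singularPoints k b = {P}) :
    ∃ i : Fin (d + 1), P = coordPoint k (Fin.castLE hdn i) := by
  classical
  have hPs : P ∈ singularPoints k b := hP ▸ Set.mem_singleton P
  obtain ⟨hPX, hPsing⟩ := hPs
  obtain ⟨i, hi⟩ := exists_rep_castLE_ne_zero hdn hD hdeg hvert hPX
  refine ⟨i, eq_coordPoint_of_mem_zeroLocus hdn hD hinj hvert hdeg hPX fun j hji => ?_⟩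
  by_contra hj
  have := IsAlgClosed.instInfinite (K := k)
  -- Acting on `t_j` alone by a `D`-th root of `y` multiplies the vertex coordinate `j` by `y` and
  -- fixes the vertex coordinate `i`. With `y ≠ 0` this is a torus element, and with `y ≠ 1` it
  -- moves `P`.
  obtain ⟨y, hy⟩ := Infinite.exists_notMem_finset ({0, 1} : Finset k)
  simp only [Finset.mem_insert, Finset.mem_singleton, not_or] at hy
  obtain ⟨μ, rfl⟩ := IsAlgClosed.exists_pow_nat_eq y hD
  have hμ : μ ≠ 0 := by rintro rfl; exact hy.1 (zero_pow hD.ne')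
  let t : Fin (d + 1) → kˣ := Function.update 1 j (Units.mk0 μ hμ)
  let s : Fin (n + 1) → kˣ := fun l => ∏ x, t x ^ b l x
  have hs : ∀ l, (s l : k) = ∏ x, (t x : k) ^ b l x := fun l => by simp [s]
  have hsvert : ∀ x, (s (Fin.castLE hdn x) : k) = (t x : k) ^ D := by
    intro x
    rw [hs, hvert, Finset.prod_eq_single x]
    · simp
    · intro y _ hy; simp [hy]
    · simp
  have hv : (fun l => (s l : k) * P.rep l) ≠ 0 := fun h =>
    hi (by simpa using congrFun h (Fin.castLE hdn i))
  let Q := Projectivization.mk k (fun l => (s l : k) * P.rep l) hv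
  have hQ : ∀ f, aeval (fun l => C (s l : k) * X l) f ∈ pointIdeal P ↔ f ∈ pointIdeal Q := by
    intro f
    rw [mem_pointIdeal_mk_iff, pointIdeal, RingHom.mem_ker, ← AlgHom.comp_apply, comp_aeval]
    have : (fun l => (aeval fun j => Polynomial.C (P.rep j) * Polynomial.X)
        (C (s l : k) * X l : MvPolynomial (Fin (n + 1)) k)) =
        fun l => Polynomial.C ((s l : k) * P.rep l) * Polynomial.X := by
      funext l
      rw [map_mul, aeval_X, ← algebraMap_eq, AlgHom.commutes, Polynomial.algebraMap_eq, map_mul,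
        mul_assoc]
    rw [this]
  have hsI : ∀ f, aeval (fun l => C (s l : k) * X l) f ∈ toricIdeal k b ↔ f ∈ toricIdeal k b := by
    intro f
    simp only [hs]
    exact rescale_mem_toricIdeal_iff t f
  have hIP := toricIdeal_le_pointIdeal hD hdeg hPX
  have hIQ : toricIdeal k b ≤ pointIdeal Q := fun f hf => (hQ f).1 (hIP ((hsI f).2 hf))
  have hQs : Q ∈ singularPoints k b := by
    refine ⟨mem_zeroLocus_of_le_pointIdeal hIQ, fun hreg => hPsing ?_⟩
    refine isRegularLocalRing_of_rescaling (toricIdeal_isPrime b) hIQ hIP (fun l => (s l)⁻¹)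
      (fun f => ?_) (fun f => ?_) hreg
    all_goals
      have hinv : aeval (fun l => C (s l : k) * X l)
          (aeval (fun l => C (((s l)⁻¹ : kˣ) : k) * X l) f : MvPolynomial (Fin (n + 1)) k) = f := by
        rw [← AlgHom.comp_apply, comp_aeval]
        conv_rhs => rw [← aeval_X_left_apply f]
        congr 2
        funext l
        rw [map_mul, aeval_X, ← algebraMap_eq, AlgHom.commutes, algebraMap_eq, ← mul_assoc, ← C_mul]
        simp
    · rw [← hsI, hinv]
    · rw [← hQ, hinv]
  rw [hP, Set.mem_singleton_iff, ← P.mk_rep, Projectivization.mk_eq_mk_iff'] at hQs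
  obtain ⟨c, hc⟩ := hQs
  have h1 := congrFun hc (Fin.castLE hdn i)
  have h2 := congrFun hc (Fin.castLE hdn j)
  simp only [Pi.smul_apply, smul_eq_mul, hsvert] at h1 h2
  have h1 := mul_right_cancel₀ hi h1
  have h2 := mul_right_cancel₀ hj h2
  simp only [t, Function.update_of_ne hji.symm, Function.update_self, Pi.one_apply, Units.val_one,
    one_pow, Units.val_mk0] at h1 h2
  exact hy.2 (h2.symm.trans h1)

end Points

/-! ### Smooth charts are affine spaces -/

section SmoothChart

variable {k : Type*} [Field k] {n d D : ℕ} {b : Fin (n + 1) → Fin (d + 1) → ℕ}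

/-- The vectors of `B` in the chart of the vertex `j`: the coordinate `j` is omitted, the other
coordinates are divided by the entries of `c`. -/
def chartExp (b : Fin (n + 1) → Fin (d + 1) → ℕ) (j : Fin (d + 1)) (c : Fin (d + 1) → ℕ)
    (l : Fin (n + 1)) : {i : Fin (d + 1) // i ≠ j} →₀ ℕ :=
  Finsupp.equivFunOnFinite.symm fun i => b l i / c i

@[simp]
lemma chartExp_apply (j : Fin (d + 1)) (c : Fin (d + 1) → ℕ) (l : Fin (n + 1))
    (i : {i : Fin (d + 1) // i ≠ j}) : chartExp b j c l i = b l i / c i := rfl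

lemma linearCombination_apply_apply {ι κ : Type*} [Fintype ι] (a : ι → κ →₀ ℕ) (u : ι →₀ ℕ)
    (i : κ) : Finsupp.linearCombination ℕ a u i = ∑ l, u l * a l i := by
  rw [Finsupp.linearCombination_apply, Finsupp.sum_fintype _ _ (by simp),
    Finsupp.finsetSum_apply]
  simp

/-- A form belongs to the toric ideal if and only if its dehomogenization at a vertex vanishes. -/
lemma monomialMap_chartExp_eq_zero_iff (hdeg : ∀ l, ∑ i, b l i = D) {j : Fin (d + 1)}
    {c : Fin (d + 1) → ℕ} (hc : ∀ i, i ≠ j → 0 < c i ∧ ∀ l, c i ∣ b l i)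
    {N : ℕ} {f : MvPolynomial (Fin (n + 1)) k} (hf : f.IsHomogeneous N) :
    monomialMap k (chartExp b j c) f = 0 ↔ f ∈ toricIdeal k b := by
  rw [toricIdeal_eq_ker, RingHom.mem_ker]
  refine monomialMap_eq_zero_iff fun u hu v hv => ?_
  set β : Fin (n + 1) → Fin (d + 1) →₀ ℕ := fun l => Finsupp.equivFunOnFinite.symm (b l) with hβ
  have hβa : ∀ l i, β l i = b l i := fun _ _ => rfl
  have hmul : ∀ (w : Fin (n + 1) →₀ ℕ) (i : {i // i ≠ j}), Finsupp.linearCombination ℕ β w i =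
      c i * Finsupp.linearCombination ℕ (chartExp b j c) w i := by
    intro w i
    rw [linearCombination_apply_apply, linearCombination_apply_apply, Finset.mul_sum]
    refine Finset.sum_congr rfl fun l _ => ?_
    rw [chartExp_apply, hβa, mul_left_comm, Nat.mul_div_cancel' ((hc i i.2).2 l)]
  -- All monomials of `f` have images of total degree `N * D`, so the omitted coordinate `j` is
  -- determined by the others.
  have hsum : ∀ w ∈ f.support, ∑ i, Finsupp.linearCombination ℕ β w i = N * D := by
    intro w hw
    simp only [linearCombination_apply_apply, hβa]
    rw [Finset.sum_comm]
    simp only [← Finset.mul_sum, hdeg]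
    rw [← Finset.sum_mul, hf.degree_eq_sum_deg_support hw]
    congr 1
    exact (Finset.sum_subset (Finset.subset_univ _) (by simp)).symm
  constructor
  · intro h
    have hoff : ∀ i, i ≠ j →
        Finsupp.linearCombination ℕ β u i = Finsupp.linearCombination ℕ β v i := fun i hi => by
      rw [hmul u ⟨i, hi⟩, hmul v ⟨i, hi⟩, h]
    ext i
    by_cases hi : i = j
    · subst hi
      have h1 := hsum u hu
      rw [← hsum v hv, ← Finset.add_sum_erase _ _ (Finset.mem_univ i),
        ← Finset.add_sum_erase _ _ (Finset.mem_univ i),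
        Finset.sum_congr rfl fun x hx => hoff x (Finset.ne_of_mem_erase hx)] at h1
      exact Nat.add_right_cancel h1
    · exact hoff i hi
  · intro h
    ext i
    have := hmul u i
    rw [h, hmul v i] at this
    exact (Nat.eq_of_mul_eq_mul_left (hc i i.2).1 this).symm

/-- The semigroup of the chart of the vertex `j` is generated by `d` vectors on its edges. -/
def SmoothChart (D : ℕ) (b : Fin (n + 1) → Fin (d + 1) → ℕ) (j : Fin (d + 1)) : Prop :=
  ∃ c : Fin (d + 1) → ℕ, ∀ i, i ≠ j → (0 < c i ∧ ∀ l, c i ∣ b l i) ∧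
    Pi.single i (c i) + Pi.single j (D - c i) ∈ Set.range b

/-- After division by the `c i`, the edge vectors of the chart become the variables, so
dehomogenization identifies the chart with affine space. -/
theorem SmoothChart.isRegularLocalRing [IsAlgClosed k] {hdn : d + 1 ≤ n + 1} (hD : 0 < D)
    (hvert : ∀ i : Fin (d + 1), b (Fin.castLE hdn i) = Pi.single i D)
    (hdeg : ∀ l, ∑ i, b l i = D) {j : Fin (d + 1)} (h : SmoothChart D b j)
    {P : Projectivization k (Fin (n + 1) → k)} (hP : P ∈ zeroLocus (toricIdeal k b))
    (hPj : P.rep (Fin.castLE hdn j) ≠ 0) :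
    IsRegularLocalRing (VarietyLocalRing (toricIdeal k b) P) := by
  obtain ⟨c, hc⟩ := h
  choose l hl using fun i : {i // i ≠ j} => (hc i i.2).2
  refine isRegularLocalRing_of_dehomogenization (toricIdeal_isPrime b)
    (toricIdeal_le_pointIdeal hD hdeg hP) (monomialMap k (chartExp b j c))
    (fun N f hf => monomialMap_chartExp_eq_zero_iff hdeg (fun i hi => (hc i hi).1) hf)
    ?_ hPj l fun i => ?_
  · rw [monomialMap_X]
    have : chartExp b j c (Fin.castLE hdn j) = 0 := by
      ext i
      simp [hvert, i.2]
    rw [this]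
    rfl
  · rw [monomialMap_X, X]
    suffices h : chartExp b j c (l i) = Finsupp.single i 1 by rw [h]
    ext x
    rw [chartExp_apply, hl]
    by_cases hx : x = i
    · subst hx
      simp [x.2, Nat.div_self (hc x x.2).1.1]
    · have hx' : (x : Fin (d + 1)) ≠ i := fun h => hx (Subtype.ext h)
      simp [x.2, hx', Ne.symm hx]

end SmoothChart

/-! ### Irreducible exponents and the embedding dimension -/

section PowerSeries

variable {k σ : Type*} [Field k]

/-- `s` is not the sum of two nonzero elements of `S`. -/
def IrreducibleIn (S : AddSubmonoid (σ →₀ ℕ)) (s : σ →₀ ℕ) : Prop :=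
  s ≠ 0 ∧ ∀ u ∈ S, ∀ v ∈ S, u + v = s → u = 0 ∨ v = 0

/-- Series supported in `S` are stable under division by those with nonzero constant term: in the
coefficient of `h * g` at `w ∉ S`, a term with `y ∈ S` nonzero has `x < w` and `x ∉ S`, so induction
leaves only `h_w g_0`. -/
lemma coeff_eq_zero_of_mul_eq {S : AddSubmonoid (σ →₀ ℕ)} {f g h : MvPowerSeries σ k}
    (hf : ∀ w ∉ S, MvPowerSeries.coeff w f = 0) (hg : ∀ w ∉ S, MvPowerSeries.coeff w g = 0)
    (hg0 : MvPowerSeries.constantCoeff g ≠ 0) (hmul : h * g = f) (w : σ →₀ ℕ) (hw : w ∉ S) :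
    MvPowerSeries.coeff w h = 0 := by
  classical
  induction w using WellFoundedLT.induction with
  | ind w ih =>
    have := hf w hw
    rw [← hmul, MvPowerSeries.coeff_mul, Finset.sum_eq_single (w, 0)] at this
    · exact (mul_eq_zero.1 this).resolve_right hg0
    · rintro ⟨x, y⟩ hxy hne
      rw [Finset.HasAntidiagonal.mem_antidiagonal] at hxy
      dsimp only at hxy ⊢
      by_cases hy : y ∈ S
      · have hx : x ∉ S := fun hx => hw (hxy ▸ add_mem hx hy)
        rw [ih x ?_ hx, zero_mul]
        have hy0 : y ≠ 0 := by
          rintro rfl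
          exact hne (by simpa using hxy)
        rw [← hxy]
        exact lt_add_of_pos_right x (pos_iff_ne_zero.2 hy0)
      · rw [hg y hy, mul_zero]
    · simp

/-- Over a ring of power series with exponents in a semigroup `S`, the monomials with irreducible
exponents are part of a minimal system of generators of the maximal ideal. -/
theorem card_le_spanFinrank {V Λ : Type*} [CommRing V] [Fintype Λ] {𝔪 : Ideal V} (hfg : 𝔪.FG)
    {S : AddSubmonoid (σ →₀ ℕ)} (Ψ : V →+* MvPowerSeries σ k)
    (hS : ∀ v, ∀ w ∉ S, MvPowerSeries.coeff w (Ψ v) = 0)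
    (h0 : ∀ v ∈ 𝔪, MvPowerSeries.constantCoeff (Ψ v) = 0)
    {e : Λ → V} (he : ∀ l, e l ∈ 𝔪) {s : Λ → σ →₀ ℕ} (hs : Function.Injective s)
    (hirr : ∀ l, IrreducibleIn S (s l)) (hΨ : ∀ l, Ψ (e l) = MvPowerSeries.monomial (s l) 1) :
    Fintype.card Λ ≤ 𝔪.spanFinrank := by
  classical
  -- Irreducibility leaves only `0 + s l` and `s l + 0`, and the latter dies because `Ψ m` has no
  -- constant term.
  have hcoeff : ∀ l, ∀ v, ∀ m ∈ 𝔪, MvPowerSeries.coeff (s l) (Ψ (v * m)) =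
      MvPowerSeries.constantCoeff (Ψ v) * MvPowerSeries.coeff (s l) (Ψ m) := by
    intro l v m hm
    rw [map_mul, MvPowerSeries.coeff_mul, Finset.sum_eq_single (0, s l)]
    · rfl
    · rintro ⟨x, y⟩ hxy hne
      rw [Finset.HasAntidiagonal.mem_antidiagonal] at hxy
      dsimp only at hxy ⊢
      by_cases hx : x ∈ S
      · by_cases hy : y ∈ S
        · rcases (hirr l).2 x hx y hy hxy with rfl | rfl
          · exact absurd (by simpa using hxy) hne
          · rw [MvPowerSeries.coeff_zero_eq_constantCoeff_apply, h0 m hm, mul_zero]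
        · rw [hS m y hy, mul_zero]
      · rw [hS v x hx, zero_mul]
    · simp
  have hfg : Submodule.FG 𝔪 := hfg
  have hTfin := hfg.finite_generators
  have hTspan : Ideal.span (𝔪.generators) = 𝔪 := 𝔪.span_generators
  have : Fintype 𝔪.generators := hTfin.fintype
  have hTmem : ∀ a : 𝔪.generators, (a : V) ∈ 𝔪 := fun a =>
    Submodule.FG.generators_mem 𝔪 a.2
  have hex : ∀ l, ∃ r : 𝔪.generators → V, ∑ a, r a * a = e l := by
    intro l
    have := he l
    rw [← hTspan] at this
    simpa using Submodule.mem_span_range_iff_exists_fun V (v := fun a : 𝔪.generators => (a : V))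
      |>.1 (by simpa using this)
  choose r hr using hex
  -- Expanding the `e l` in a minimal set of generators factors the identity matrix through these
  -- generators, which bounds its rank.
  let A : Matrix Λ 𝔪.generators k := fun l a => MvPowerSeries.constantCoeff (Ψ (r l a))
  let B : Matrix 𝔪.generators Λ k := fun a l => MvPowerSeries.coeff (s l) (Ψ a)
  have hAB : A * B = 1 := by
    ext l l'
    rw [Matrix.mul_apply, Matrix.one_apply]
    simp only [A, B, ← hcoeff l' _ _ (hTmem _)]
    rw [← map_sum, ← map_sum, hr, hΨ, MvPowerSeries.coeff_monomial]
    simp [hs.eq_iff, eq_comm]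
  calc Fintype.card Λ = (A * B).rank := by rw [hAB, Matrix.rank_one]
    _ ≤ A.rank := Matrix.rank_mul_le_left _ _
    _ ≤ Fintype.card 𝔪.generators := Matrix.rank_le_card_width _
    _ = 𝔪.spanFinrank := by
      rw [← hfg.generators_ncard, Set.ncard_eq_toFinset_card', Set.toFinset_card]

end PowerSeries

/-! ### Semigroups with few irreducible elements -/

section Semigroup

variable {ι σ : Type*}

lemma exists_eq_of_irreducibleIn {a : ι → σ →₀ ℕ} {s : σ →₀ ℕ}
    (hs : s ∈ AddSubmonoid.closure (Set.range a))
    (hirr : IrreducibleIn (AddSubmonoid.closure (Set.range a)) s) : ∃ l, a l = s := by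
  induction hs using AddSubmonoid.closure_induction_left with
  | zero => exact absurd rfl hirr.1
  | add_left x hx y hy ih =>
    rcases hirr.2 x (AddSubmonoid.subset_closure hx) y hy rfl with rfl | rfl
    · rw [zero_add] at hirr ⊢
      exact ih hirr
    · simpa using hx

/-- A semigroup in `ℕ^σ` which meets all coordinate axes and has at most `|σ|` irreducible elements
is generated by multiples of the basis vectors. -/
theorem exists_single_of_card_irreducibleIn_le [Finite ι] [Finite σ] {a : ι → σ →₀ ℕ} {D : ℕ} (hD : 0 < D)
    (hmem : ∀ i, Finsupp.single i D ∈ AddSubmonoid.closure (Set.range a))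
    (hcard : Nat.card {l // IrreducibleIn (AddSubmonoid.closure (Set.range a)) (a l)} ≤
      Nat.card σ) :
    ∃ c : σ → ℕ, ∀ i, 0 < c i ∧ (∀ l, c i ∣ a l i) ∧ ∃ l, a l = Finsupp.single i (c i) := by
  classical
  set S := AddSubmonoid.closure (Set.range a) with hS
  -- The least positive multiple of `ε_i` in `S` is irreducible, since summands of an axis vector
  -- lie on the same axis.
  have hax : ∀ i, ∃ c, 0 < c ∧ ∃ l : {l // IrreducibleIn S (a l)}, a l = Finsupp.single i c := by
    intro i
    have hex : ∃ c, 0 < c ∧ Finsupp.single i c ∈ S := ⟨D, hD, hmem i⟩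
    obtain ⟨hc, hcS⟩ := Nat.find_spec hex
    set c := Nat.find hex
    have hirr : IrreducibleIn S (Finsupp.single i c) := by
      refine ⟨by simpa using hc.ne', fun u hu v hv huv => ?_⟩
      have hsingle : ∀ w ∈ S, w ≤ Finsupp.single i c → w = Finsupp.single i (w i) := by
        intro w _ hw
        ext x
        by_cases hx : x = i
        · subst hx; simp
        · have := hw x
          simp only [Finsupp.single_apply, Ne.symm hx, if_false] at this ⊢
          omega
      have hu' := hsingle u hu (huv ▸ le_self_add)
      have hv' := hsingle v hv (huv ▸ le_add_self)
      have hi : u i + v i = c := by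
        have := DFunLike.congr_fun huv i
        simpa using this
      by_contra! h
      have hui : u i ≠ 0 := fun h0 => h.1 (by rw [hu', h0, Finsupp.single_zero])
      have hvi : v i ≠ 0 := fun h0 => h.2 (by rw [hv', h0, Finsupp.single_zero])
      exact Nat.find_min hex (m := u i) (by change u i < c; omega)
        ⟨Nat.pos_of_ne_zero hui, hu' ▸ hu⟩
    obtain ⟨l, hl⟩ := exists_eq_of_irreducibleIn hcS hirr
    exact ⟨c, hc, ⟨l, hl ▸ hirr⟩, hl⟩
  choose c hc f hf using hax
  have hinj : Function.Injective f := by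
    intro i i' h
    have h1 := hf i
    rw [h, hf i', Finsupp.single_eq_single_iff] at h1
    rcases h1 with h1 | h1
    · exact h1.1.symm
    · exact absurd h1.2 (hc i).ne'
  have hsurj : Function.Surjective f := (hinj.bijective_of_nat_card_le hcard).2
  -- By the count, every irreducible is some `c i' ε_i'`; divisibility passes to sums by induction.
  have hdvd : ∀ s ∈ S, ∀ i, c i ∣ s i := by
    intro s
    induction s using WellFoundedLT.induction with
    | ind s ih =>
      intro hs i
      by_cases hs0 : s = 0
      · simp [hs0]
      by_cases hirr : IrreducibleIn S s
      · obtain ⟨l, rfl⟩ := exists_eq_of_irreducibleIn hs hirr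
        obtain ⟨i', hi'⟩ := hsurj ⟨l, hirr⟩
        have : a l = Finsupp.single i' (c i') := by rw [← hf i', hi']
        rw [this, Finsupp.single_apply]
        split_ifs with h
        · rw [h]
        · exact dvd_zero _
      · simp only [IrreducibleIn, not_and, not_forall, not_or] at hirr
        obtain ⟨u, hu, v, hv, huv, hu0, hv0⟩ := hirr hs0
        have hus : u < s := huv ▸ lt_add_of_pos_right u (pos_iff_ne_zero.2 hv0)
        have hvs : v < s := huv ▸ lt_add_of_pos_left v (pos_iff_ne_zero.2 hu0)
        rw [← huv, Finsupp.add_apply]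
        exact dvd_add (ih u hus hu i) (ih v hvs hv i)
  exact ⟨c, fun i => ⟨hc i, fun l => hdvd _ (AddSubmonoid.subset_closure ⟨l, rfl⟩) i,
    ⟨f i, hf i⟩⟩⟩

end Semigroup

/-! ### Local rings at the coordinate points -/

section CoordPoint

variable {k : Type*} [Field k] {n : ℕ} {J : Fin (n + 1)}

lemma mem_pointIdeal_coordPoint_iff {f : MvPolynomial (Fin (n + 1)) k} {N : ℕ}
    (hf : f.IsHomogeneous N) :
    f ∈ pointIdeal (coordPoint k J) ↔ eval (Pi.single J 1) f = 0 := by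
  obtain ⟨a, ha⟩ := Projectivization.exists_smul_eq_mk_rep k
    (Pi.single J 1 : Fin (n + 1) → k) (by simp)
  have h := IsHomogeneous.aeval_mul_left hf (a : k) (Pi.single J 1)
  rw [mem_pointIdeal_iff hf, coordPoint, ← ha, ← coe_aeval_eq_eval, ← coe_aeval_eq_eval]
  change aeval (fun l => (a : k) * (Pi.single J 1 : Fin (n + 1) → k) l) f = 0 ↔ _
  rw [h, mul_eq_zero, or_iff_right (pow_ne_zero _ a.ne_zero)]
  rfl

lemma X_pow_notMem_pointIdeal (N : ℕ) :
    (X J ^ N : MvPolynomial (Fin (n + 1)) k) ∉ pointIdeal (coordPoint k J) := by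
  rw [mem_pointIdeal_coordPoint_iff (isHomogeneous_X_pow J N)]
  simp

/-- The only monomial of degree `N` outside the span is `X J ^ N`, and its coefficient in `f` is the
value of `f` at the coordinate point. -/
lemma mem_span_X_of_mem_pointIdeal {f : MvPolynomial (Fin (n + 1)) k} {N : ℕ}
    (hf : f.IsHomogeneous N) (hfJ : f ∈ pointIdeal (coordPoint k J)) :
    f ∈ Ideal.span (X '' {l | l ≠ J}) := by
  classical
  have hsingle : ∀ u ∈ f.support, (∀ l, l ≠ J → u l = 0) → u = Finsupp.single J N := by
    intro u hu h
    have hN : N = u J := by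
      rw [hf.degree_eq_sum_deg_support hu, Finset.sum_eq_single J (fun l _ hl => h l hl) (by simp)]
    ext l
    by_cases hl : l = J
    · subst hl; simp [hN]
    · rw [h l hl, Finsupp.single_apply, if_neg (Ne.symm hl)]
  rw [mem_ideal_span_X_image]
  intro u hu
  by_contra! h
  rw [mem_pointIdeal_coordPoint_iff hf, eval_eq', Finset.sum_eq_single u] at hfJ
  · rw [mem_support_iff] at hu
    apply hu
    rw [Finset.prod_eq_one, mul_one] at hfJ
    · exact hfJ
    · intro l _
      by_cases hl : l = J
      · subst hl; simp
      · simp [h l hl]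
  · intro v hv hne
    obtain ⟨l, hl, hvl⟩ : ∃ l, l ≠ J ∧ v l ≠ 0 := by
      by_contra! h'
      exact hne ((hsingle v hv h').trans (hsingle u hu h).symm)
    rw [Finset.prod_eq_zero (Finset.mem_univ l), mul_zero]
    simp [hl, hvl]
  · exact fun h => absurd hu h

lemma frac_mul_frac {P : Projectivization k (Fin (n + 1) → k)} {N : ℕ}
    {f g h : MvPolynomial (Fin (n + 1)) k} (hf : f.IsHomogeneous N) (hg : g.IsHomogeneous N)
    (hh : h.IsHomogeneous N) (hgP : g ∉ pointIdeal P) (hhP : h ∉ pointIdeal P) :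
    frac f h hf hh hhP * frac h g hh hg hgP = frac f g hf hg hgP := by
  apply HomogeneousLocalization.val_injective
  rw [HomogeneousLocalization.val_mul, val_frac, val_frac, val_frac, Localization.mk_mul,
    Localization.mk_eq_mk_iff, Localization.r_iff_exists]
  exact ⟨1, by simp; ring⟩

lemma isUnit_frac_iff {P : Projectivization k (Fin (n + 1) → k)} {N : ℕ}
    {f g : MvPolynomial (Fin (n + 1)) k} (hf : f.IsHomogeneous N) (hg : g.IsHomogeneous N)
    (hgP : g ∉ pointIdeal P) : IsUnit (frac f g hf hg hgP) ↔ f ∉ pointIdeal P := by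
  rw [← HomogeneousLocalization.isUnit_iff_isUnit_val, val_frac, Localization.mk_eq_mk',
    IsLocalization.AtPrime.isUnit_mk'_iff _ (pointIdeal P)]
  rfl

lemma mk_frac_mem_maximalIdeal_iff {I : Ideal (MvPolynomial (Fin (n + 1)) k)}
    {P : Projectivization k (Fin (n + 1) → k)} [IsLocalRing (VarietyLocalRing I P)] {N : ℕ}
    {f g : MvPolynomial (Fin (n + 1)) k} (hf : f.IsHomogeneous N) (hg : g.IsHomogeneous N)
    (hgP : g ∉ pointIdeal P) :
    Ideal.Quotient.mk (localIdeal I P) (frac f g hf hg hgP) ∈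
      IsLocalRing.maximalIdeal (VarietyLocalRing I P) ↔ f ∈ pointIdeal P := by
  have := IsLocalHom.of_surjective (Ideal.Quotient.mk (localIdeal I P))
    Ideal.Quotient.mk_surjective
  rw [IsLocalRing.mem_maximalIdeal, mem_nonunits_iff, isUnit_map_iff, isUnit_frac_iff, not_not]

/-- The evaluation of polynomials at the affine coordinates `x_l / x_J` of the chart of `P_J`. -/
def affineEval (k : Type*) [Field k] {n : ℕ} (J : Fin (n + 1)) :
    MvPolynomial (Fin (n + 1)) k →+* ProjLocalRing (coordPoint k J) :=
  eval₂Hom ((algebraMap (homogeneousSubmodule (Fin (n + 1)) k 0) _).comp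
    (algebraMap k (homogeneousSubmodule (Fin (n + 1)) k 0)))
    fun l => frac (X l) (X J ^ 1) (isHomogeneous_X k l) (isHomogeneous_X_pow J 1)
      (X_pow_notMem_pointIdeal 1)

lemma affineEval_X (l : Fin (n + 1)) :
    affineEval k J (X l) = frac (X l) (X J ^ 1) (isHomogeneous_X k l) (isHomogeneous_X_pow J 1)
      (X_pow_notMem_pointIdeal 1) := by
  simp [affineEval]

lemma affineEval_eq_frac {f : MvPolynomial (Fin (n + 1)) k} {N : ℕ} (hf : f.IsHomogeneous N) :
    affineEval k J f = frac f (X J ^ N) hf (isHomogeneous_X_pow J N)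
      (X_pow_notMem_pointIdeal N) := by
  apply HomogeneousLocalization.val_injective
  let L := Localization.AtPrime (pointIdeal (coordPoint k J))
  let w : L := Localization.mk 1 ⟨X J ^ 1, X_pow_notMem_pointIdeal 1⟩
  have hval : (affineEval k J f).val =
      aeval (fun l => w * algebraMap (MvPolynomial (Fin (n + 1)) k) L (X l)) f := by
    rw [← HomogeneousLocalization.algebraMap_apply]
    have : (algebraMap (ProjLocalRing (coordPoint k J)) L).comp (affineEval k J) =
        ((aeval (fun l => w * algebraMap (MvPolynomial (Fin (n + 1)) k) L (X l)) :
          MvPolynomial (Fin (n + 1)) k →ₐ[k] L) : MvPolynomial (Fin (n + 1)) k →+* L) := by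
      ext x
      · simp only [affineEval, RingHom.comp_apply, eval₂Hom_C, RingHom.coe_coe, aeval_C]
        rfl
      · rw [RingHom.comp_apply, affineEval_X, HomogeneousLocalization.algebraMap_apply, val_frac,
          RingHom.coe_coe, aeval_X, ← Localization.mk_one_eq_algebraMap, Localization.mk_mul]
        simp
    exact congrArg (fun φ => φ f) this
  rw [hval, IsHomogeneous.aeval_mul_left hf, val_frac, Localization.mk_pow]
  have : aeval (fun l => algebraMap (MvPolynomial (Fin (n + 1)) k) L (X l)) f =
      algebraMap (MvPolynomial (Fin (n + 1)) k) L f := by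
    have h := aeval_algebraMap_apply (R := k) L (X : Fin (n + 1) → MvPolynomial (Fin (n + 1)) k) f
    rwa [aeval_X_left_apply] at h
  rw [this, ← Localization.mk_one_eq_algebraMap, Localization.mk_mul]
  congr 1
  · simp
  · ext
    simp

end CoordPoint

/-! ### Dimension bound at a vertex -/

section Vertex

variable {k : Type*} [Field k] [IsAlgClosed k] {n d D : ℕ} {b : Fin (n + 1) → Fin (d + 1) → ℕ}
  {hdn : d + 1 ≤ n + 1}

/-- At a vertex, the dimension of the toric variety is at most `d`, since its maximal ideal is the
radical of the ideal of the `d` functions `x_i / x_j`. -/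
theorem ringKrullDim_varietyLocalRing_le (hD : 0 < D) (hinj : Function.Injective b)
    (hvert : ∀ i : Fin (d + 1), b (Fin.castLE hdn i) = Pi.single i D)
    (hdeg : ∀ l, ∑ i, b l i = D) (j : Fin (d + 1))
    [IsLocalRing (VarietyLocalRing (toricIdeal k b) (coordPoint k (Fin.castLE hdn j)))]
    [IsNoetherianRing (VarietyLocalRing (toricIdeal k b) (coordPoint k (Fin.castLE hdn j)))] :
    ringKrullDim (VarietyLocalRing (toricIdeal k b) (coordPoint k (Fin.castLE hdn j))) ≤
      (Nat.card {i : Fin (d + 1) // i ≠ j} : ℕ) := by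
  set J := Fin.castLE hdn j with hJ
  set P := coordPoint k J
  let V := VarietyLocalRing (toricIdeal k b) P
  have hI := toricIdeal_isPrime (k := k) b
  have hIP := toricIdeal_le_pointIdeal hD hdeg
    (coordPoint_mem_zeroLocus (k := k) hdn hD hinj hvert hdeg j)
  let π : ProjLocalRing P →+* V := Ideal.Quotient.mk (localIdeal (toricIdeal k b) P)
  let θ : MvPolynomial (Fin (n + 1)) k →+* V := π.comp (affineEval k J)
  have hθ : ∀ {N : ℕ} {f : MvPolynomial (Fin (n + 1)) k}, f.IsHomogeneous N →
      f ∈ toricIdeal k b → θ f = 0 := by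
    intro N f hf hfI
    change π (affineEval k J f) = 0
    rw [affineEval_eq_frac hf, Ideal.Quotient.eq_zero_iff_mem, frac_mem_localIdeal_iff hI hIP]
    exact hfI
  have hθX : ∀ l, θ (X l) = π (frac (X l) (X J ^ 1) (isHomogeneous_X k l)
      (isHomogeneous_X_pow J 1) (X_pow_notMem_pointIdeal 1)) := fun l =>
    congrArg π (affineEval_X l)
  let z : {i : Fin (d + 1) // i ≠ j} → V := fun i => θ (X (Fin.castLE hdn i))
  -- A prime containing the `x_i / x_J` contains the `D`-th power of each `x_l / x_J`, `l ≠ J`,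
  -- hence the whole maximal ideal; Krull's height theorem then applies.
  have hmin : IsLocalRing.maximalIdeal V ∈ (Ideal.span (Set.range z)).minimalPrimes := by
    refine ⟨⟨inferInstance, ?_⟩, ?_⟩
    · rw [Ideal.span_le]
      rintro _ ⟨i, rfl⟩
      have hiJ : Fin.castLE hdn i ≠ J := fun h => i.2 (Fin.castLE_injective hdn h)
      rw [SetLike.mem_coe]
      change θ (X (Fin.castLE hdn i)) ∈ _
      rw [hθX]
      rw [mk_frac_mem_maximalIdeal_iff, mem_pointIdeal_coordPoint_iff (isHomogeneous_X k _)]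
      simp [hiJ]
    · rintro q ⟨hq, hzq⟩ -
      have hzq : ∀ i : {i : Fin (d + 1) // i ≠ j}, θ (X (Fin.castLE hdn i)) ∈ q := fun i =>
        hzq (Ideal.subset_span ⟨i, rfl⟩)
      have hX : ∀ l, l ≠ J → θ (X l) ∈ q := by
        intro l hl
        refine hq.mem_of_pow_mem D ?_
        have h0 := hθ (isHomogeneous_X_pow_sub_prod hdn hdeg l)
          (X_pow_sub_prod_mem_toricIdeal hdn hvert l)
        rw [map_sub, sub_eq_zero, map_pow, map_prod] at h0
        rw [h0]
        obtain ⟨i, hij, hi⟩ := exists_ne_zero_of_ne_castLE hdn hinj hvert hdeg hl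
        refine Ideal.mem_of_dvd _ (Finset.dvd_prod_of_mem _ (Finset.mem_univ i)) ?_
        rw [map_pow]
        exact Ideal.pow_mem_of_mem _ (hzq ⟨i, hij⟩) _ (Nat.pos_of_ne_zero hi)
      have hspan : Ideal.span (X '' {l | l ≠ J}) ≤ q.comap θ := by
        rw [Ideal.span_le]
        rintro _ ⟨l, hl, rfl⟩
        exact hX l hl
      intro v hv
      obtain ⟨w, rfl⟩ := Ideal.Quotient.mk_surjective v
      obtain ⟨N, f, g, hf, hg, hgP, rfl⟩ := exists_eq_frac w
      rw [mk_frac_mem_maximalIdeal_iff] at hv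
      rw [← frac_mul_frac hf hg (isHomogeneous_X_pow J N) hgP (X_pow_notMem_pointIdeal N),
        map_mul, ← affineEval_eq_frac hf]
      exact Ideal.mul_mem_right _ _ (hspan (mem_span_X_of_mem_pointIdeal hf hv))
  rw [← IsLocalRing.maximalIdeal_height_eq_ringKrullDim]
  have h1 := Ideal.height_le_card_of_mem_minimalPrimes_span (Set.finite_range z) hmin
  have h2 : (Set.range z).ncard ≤ Nat.card {i : Fin (d + 1) // i ≠ j} := by
    rw [← Set.image_univ, ← Set.ncard_univ]
    exact Set.ncard_image_le
  exact_mod_cast h1.trans (Nat.cast_le.2 h2)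

end Vertex

/-! ### Regular vertices have smooth charts -/

section Vertex

variable {k : Type*} [Field k] [IsAlgClosed k] {n d D : ℕ} {b : Fin (n + 1) → Fin (d + 1) → ℕ}
  {hdn : d + 1 ≤ n + 1}

/-- Regularity equates the embedding dimension with the Krull dimension, which is at most the number
of axes. Expanding functions in power series at the vertex then bounds the number of irreducibles of
the chart semigroup. -/
theorem smoothChart_of_isRegularLocalRing (hD : 0 < D) (hinj : Function.Injective b)
    (hvert : ∀ i : Fin (d + 1), b (Fin.castLE hdn i) = Pi.single i D)
    (hdeg : ∀ l, ∑ i, b l i = D) {j : Fin (d + 1)}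
    (hreg : IsRegularLocalRing
      (VarietyLocalRing (toricIdeal k b) (coordPoint k (Fin.castLE hdn j)))) :
    SmoothChart D b j := by
  classical
  have hdim := ringKrullDim_varietyLocalRing_le (k := k) hD hinj hvert hdeg j
  rw [← hreg.spanFinrank_maximalIdeal, Nat.cast_le] at hdim
  have hIP := toricIdeal_le_pointIdeal hD hdeg
    (coordPoint_mem_zeroLocus (k := k) hdn hD hinj hvert hdeg j)
  set J := Fin.castLE hdn j with hJ
  set P := coordPoint k J
  have hI := toricIdeal_isPrime (k := k) b
  set a : Fin (n + 1) → {i : Fin (d + 1) // i ≠ j} →₀ ℕ := chartExp b j fun _ => 1 with ha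
  have hab : ∀ l i, a l i = b l i := fun l i => by rw [ha, chartExp_apply, Nat.div_one]
  have hbj : ∀ l, b l j = D - ∑ i, a l i := by
    intro l
    have h1 := Fintype.sum_eq_add_sum_subtype_ne (b l) j
    rw [hdeg] at h1
    simp only [hab]
    omega
  have hainj : Function.Injective a := by
    intro l l' h
    apply hinj
    funext i
    by_cases hi : i = j
    · rw [hi, hbj, hbj, h]
    · rw [← hab l ⟨i, hi⟩, ← hab l' ⟨i, hi⟩, h]
  have haJ : a J = 0 := by
    ext i
    rw [hab, hvert, Pi.single_eq_of_ne i.2]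
    rfl
  set S := AddSubmonoid.closure (Set.range a) with hS
  -- Power series are used because forms not vanishing at `P` must become units.
  let φ : MvPolynomial (Fin (n + 1)) k →+* MvPowerSeries {i : Fin (d + 1) // i ≠ j} k :=
    coeToMvPowerSeries.ringHom.comp
      (monomialMap k a : MvPolynomial (Fin (n + 1)) k →+* MvPolynomial {i // i ≠ j} k)
  have hφa : ∀ f, φ f = ((monomialMap k a f : MvPolynomial {i : Fin (d + 1) // i ≠ j} k) :
      MvPowerSeries {i : Fin (d + 1) // i ≠ j} k) := fun _ => rfl
  have hφX : ∀ l, φ (X l) = MvPowerSeries.monomial (a l) 1 := by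
    intro l
    rw [hφa, monomialMap_X, coe_monomial]
  have hφ0 : ∀ f, MvPowerSeries.constantCoeff (φ f) = eval (Pi.single J 1) f := by
    intro f
    have : (MvPowerSeries.constantCoeff (R := k)).comp φ = eval (Pi.single J 1) := by
      ext x
      · rw [RingHom.comp_apply, RingHom.comp_apply, hφa, ← algebraMap_eq, AlgHom.commutes,
          algebraMap_eq, coe_C]
        simp
      · rw [RingHom.comp_apply, hφX, eval_X, ← MvPowerSeries.coeff_zero_eq_constantCoeff_apply,
          MvPowerSeries.coeff_monomial]
        by_cases hx : x = J
        · simp [hx, haJ]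
        · have hx' : a x ≠ 0 := fun h => hx (hainj (h.trans haJ.symm))
          simp [hx, hx'.symm]
    exact congrArg (fun ψ => ψ f) this
  have hφu : ∀ (N : ℕ) (g : MvPolynomial (Fin (n + 1)) k), g.IsHomogeneous N →
      g ∉ pointIdeal P → IsUnit (φ g) := by
    intro N g hg hgP
    rw [MvPowerSeries.isUnit_iff_constantCoeff, hφ0, isUnit_iff_ne_zero]
    rwa [mem_pointIdeal_coordPoint_iff hg] at hgP
  have hφI : ∀ {N : ℕ} {f : MvPolynomial (Fin (n + 1)) k}, f.IsHomogeneous N →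
      f ∈ toricIdeal k b → φ f = 0 := by
    intro N f hf hfI
    have := (monomialMap_chartExp_eq_zero_iff (j := j) (c := fun _ => 1) hdeg
      (fun i _ => ⟨one_pos, fun l => one_dvd _⟩) hf).2 hfI
    rw [hφa, this, coe_zero]
  have hφS : ∀ f, ∀ w ∉ S, MvPowerSeries.coeff w (φ f) = 0 := by
    intro f w hw
    rw [hφa, coeff_coe, coeff_monomialMap, Finset.filter_false_of_mem, Finset.sum_empty]
    rintro u - rfl
    apply hw
    rw [Finsupp.linearCombination_apply]
    exact sum_mem fun l _ => nsmul_mem (AddSubmonoid.subset_closure (Set.mem_range_self l)) _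
  let Ψ : VarietyLocalRing (toricIdeal k b) P →+* MvPowerSeries {i // i ≠ j} k :=
    Ideal.Quotient.lift (localIdeal (toricIdeal k b) P) (projLift φ hφu) (by
      intro z hz
      obtain ⟨N, f, g, hf, hg, hgP, rfl⟩ := exists_eq_frac z
      rw [frac_mem_localIdeal_iff hI hIP] at hz
      rw [← (hφu N g hg hgP).mul_left_eq_zero, projLift_frac_mul, hφI hf hz])
  have hΨ : ∀ {N : ℕ} {f g : MvPolynomial (Fin (n + 1)) k} (hf : f.IsHomogeneous N)
      (hg : g.IsHomogeneous N) (hgP : g ∉ pointIdeal P),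
      Ψ (Ideal.Quotient.mk _ (frac f g hf hg hgP)) * φ g = φ f := fun hf hg hgP =>
    projLift_frac_mul φ hφu hf hg hgP
  have hcard : Nat.card {l // IrreducibleIn S (a l)} ≤ Nat.card {i : Fin (d + 1) // i ≠ j} := by
    refine le_trans ?_ hdim
    rw [Nat.card_eq_fintype_card]
    refine card_le_spanFinrank (IsNoetherian.noetherian _) (S := S) Ψ ?_ ?_
      (e := fun l => Ideal.Quotient.mk _ (frac (X l.1) (X J ^ 1) (isHomogeneous_X k l.1)
        (isHomogeneous_X_pow J 1) (X_pow_notMem_pointIdeal 1)))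
      ?_ (s := fun l => a l) (hainj.comp Subtype.val_injective) (fun l => l.2) ?_
    · intro v
      obtain ⟨z, rfl⟩ := Ideal.Quotient.mk_surjective v
      obtain ⟨N, f, g, hf, hg, hgP, rfl⟩ := exists_eq_frac z
      refine coeff_eq_zero_of_mul_eq (hφS f) (hφS g) ?_ (hΨ hf hg hgP)
      rwa [hφ0, ne_eq, ← mem_pointIdeal_coordPoint_iff hg]
    · intro v hv
      obtain ⟨z, rfl⟩ := Ideal.Quotient.mk_surjective v
      obtain ⟨N, f, g, hf, hg, hgP, rfl⟩ := exists_eq_frac z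
      rw [mk_frac_mem_maximalIdeal_iff, mem_pointIdeal_coordPoint_iff hf, ← hφ0,
        ← hΨ hf hg hgP, map_mul, mul_eq_zero] at hv
      refine hv.resolve_right ?_
      rwa [hφ0, ← mem_pointIdeal_coordPoint_iff hg]
    · intro l
      rw [mk_frac_mem_maximalIdeal_iff, mem_pointIdeal_coordPoint_iff (isHomogeneous_X k _)]
      have hlJ : l.1 ≠ J := fun h => l.2.1 (by rw [h, haJ])
      rw [eval_X, Pi.single_eq_of_ne hlJ]
    · intro l
      have := hΨ (isHomogeneous_X k l.1) (isHomogeneous_X_pow J 1) (X_pow_notMem_pointIdeal 1)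
      rw [map_pow, hφX, hφX, haJ, MvPowerSeries.monomial_zero_one, one_pow, mul_one] at this
      exact this
  have hmem : ∀ i : {i : Fin (d + 1) // i ≠ j}, Finsupp.single i D ∈ S := by
    intro i
    refine AddSubmonoid.subset_closure ⟨Fin.castLE hdn i, ?_⟩
    ext x
    rw [hab, hvert, Finsupp.single_apply, Pi.single_apply]
    simp only [eq_comm, Subtype.ext_iff]
  obtain ⟨c, hc⟩ := exists_single_of_card_irreducibleIn_le hD hmem hcard
  refine ⟨fun i => if h : i ≠ j then c ⟨i, h⟩ else 1, fun i hi => ?_⟩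
  obtain ⟨hc0, hdvd, l, hl⟩ := hc ⟨i, hi⟩
  simp only [hi, ne_eq, not_false_eq_true, dite_true]
  refine ⟨⟨hc0, fun l => ?_⟩, l, ?_⟩
  · simpa only [hab] using hdvd l
  · funext x
    by_cases hx : x = j
    · subst hx
      rw [hbj, hl]
      simp [Finsupp.single_apply, Ne.symm hi]
    · rw [← hab l ⟨x, hx⟩, hl, Finsupp.single_apply]
      simp only [Pi.add_apply, Pi.single_eq_of_ne hx, add_zero, Pi.single_apply, Subtype.mk.injEq]
      simp only [eq_comm]

end Vertex

/-! ### Combinatorics of a single singular vertex -/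

section OneSingular

variable {n d D : ℕ} {b : Fin (n + 1) → Fin (d + 1) → ℕ} {hdn : d + 1 ≤ n + 1}

lemma coordPoint_rep_self_ne_zero (k : Type*) [Field k] (J : Fin (n + 1)) :
    (coordPoint k J).rep J ≠ 0 := by
  obtain ⟨a, ha⟩ := Projectivization.exists_smul_eq_mk_rep k
    (Pi.single J 1 : Fin (n + 1) → k) (by simp)
  rw [coordPoint, ← ha]
  simp [Units.smul_def]

lemma coordPoint_injective (k : Type*) [Field k] :
    Function.Injective (coordPoint k : Fin (n + 1) → Projectivization k (Fin (n + 1) → k)) := by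
  intro i j h
  rw [coordPoint, coordPoint, Projectivization.mk_eq_mk_iff'] at h
  obtain ⟨a, ha⟩ := h
  by_contra hij
  have := congrFun ha i
  simp [hij] at this

lemma coordPoint_mem_singularPoints_iff (k : Type*) [Field k] [IsAlgClosed k] (hD : 0 < D)
    (hinj : Function.Injective b)
    (hvert : ∀ i : Fin (d + 1), b (Fin.castLE hdn i) = Pi.single i D)
    (hdeg : ∀ l, ∑ i, b l i = D) (j : Fin (d + 1)) :
    coordPoint k (Fin.castLE hdn j) ∈ singularPoints k b ↔ ¬ SmoothChart D b j := by
  have hP := coordPoint_mem_zeroLocus (k := k) hdn hD hinj hvert hdeg j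
  refine ⟨fun h hs => h.2 (hs.isRegularLocalRing hD hvert hdeg hP
    (coordPoint_rep_self_ne_zero k _)), fun h => ⟨hP, fun hreg => h ?_⟩⟩
  exact smoothChart_of_isRegularLocalRing hD hinj hvert hdeg hreg

lemma OneSingularShape.smoothChart (h : OneSingularShape D b) {j : Fin (d + 1)} (hj : j ≠ 0) :
    SmoothChart D b j := by
  obtain ⟨e, he, -, hdvd, h1, h2, -⟩ := h
  -- At a vertex `j ≠ 0`, the edge towards `0` has step `e` and every other edge has step `1`.
  refine ⟨fun i => if i = 0 then e else 1, fun i hi => ?_⟩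
  by_cases hi0 : i = 0
  · subst hi0
    simpa using ⟨⟨he, hdvd⟩, h2 j hj⟩
  · have := h1 j i hj hi0
    rw [add_comm (Pi.single _ _)] at this
    simpa [hi0] using this

/-- With at most two coordinates summing to `D`, a divisor of `D` and of one coordinate divides the
other. This is how the gcd hypothesis enters when `d ≤ 1`. -/
lemma dvd_of_dvd_of_le_one (hvert : ∀ i : Fin (d + 1), b (Fin.castLE hdn i) = Pi.single i D)
    (hdeg : ∀ l, ∑ i, b l i = D) (hd : d ≤ 1) {x : ℕ} {i : Fin (d + 1)}
    (hx : ∀ l, x ∣ b l i) (l : Fin (n + 1)) (i' : Fin (d + 1)) : x ∣ b l i' := by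
  by_cases hi : i' = i
  · exact hi ▸ hx l
  have hxD : x ∣ D := by
    have := hx (Fin.castLE hdn i)
    rwa [hvert, Pi.single_eq_same] at this
  have hsum := Finset.add_sum_erase Finset.univ (b l) (Finset.mem_univ i)
  rw [hdeg, Finset.sum_eq_single i' ?_ (by simp [hi])] at hsum
  · exact (Nat.dvd_add_right (hx l)).1 (hsum ▸ hxD)
  · intro m hm hm'
    exfalso
    have := Finset.ne_of_mem_erase hm
    have h1 := m.2
    have h2 := i.2
    have h3 := i'.2
    rw [ne_eq, Fin.ext_iff] at *
    omega

lemma OneSingularShape.not_smoothChart_zero (hD : 0 < D)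
    (hvert : ∀ i : Fin (d + 1), b (Fin.castLE hdn i) = Pi.single i D)
    (hdeg : ∀ l, ∑ i, b l i = D) (h : OneSingularShape D b)
    (hd : 2 ≤ d ∨ ∀ g : ℕ, (∀ l i, g ∣ b l i) → g = 1) : ¬ SmoothChart D b 0 := by
  rintro ⟨c, hc⟩
  obtain ⟨e, he, heD, hdvd, h1, -, h3⟩ := h
  have hnot : (∀ j : Fin (d + 1), j ≠ 0 → c j = 1) → e = 1 → False := by
    intro hc1 he1
    obtain ⟨j, hj, hjB⟩ := h3 he1
    have := (hc j hj).2
    rw [hc1 j hj, add_comm (Pi.single _ _)] at this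
    exact hjB this
  by_cases hd2 : 2 ≤ d
  -- For `d ≥ 2` there is a third index `i`, and `(D-1)ε_i + ε_j ∈ B` has `j`-th entry `1`, which
  -- forces `c j = 1`.
  · have hc1 : ∀ j : Fin (d + 1), j ≠ 0 → c j = 1 := by
      intro j hj
      obtain ⟨i, hi0, hij⟩ : ∃ i : Fin (d + 1), i ≠ 0 ∧ i ≠ j := by
        by_cases hj1 : (j : ℕ) = 1
        · exact ⟨⟨2, by omega⟩, by simp [Fin.ext_iff], by simp [Fin.ext_iff, hj1]⟩
        · exact ⟨⟨1, by omega⟩, by simp [Fin.ext_iff], by simpa [Fin.ext_iff] using Ne.symm hj1⟩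
      obtain ⟨l, hl⟩ := h1 i j hi0 hj
      have := (hc j hj).1.2 l
      rw [hl] at this
      simpa [Pi.single_eq_of_ne hij.symm] using this
    refine hnot hc1 ?_
    -- Now `(D-1)ε_0 + ε_1 ∈ B`, so `e` divides both `D` and `D - 1`.
    have hj : (⟨1, by omega⟩ : Fin (d + 1)) ≠ 0 := by simp [Fin.ext_iff]
    obtain ⟨l, hl⟩ := (hc _ hj).2
    have := hdvd l
    rw [hl, hc1 _ hj] at this
    simp only [Pi.add_apply, Pi.single_eq_of_ne hj.symm, Pi.single_eq_same, zero_add] at this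
    have h1 := (Nat.dvd_sub heD this)
    rwa [Nat.sub_sub_self hD, Nat.dvd_one] at h1
  · have hgcd := hd.resolve_left hd2
    refine hnot (fun j hj => hgcd _ ?_) (hgcd _ ?_)
    · exact dvd_of_dvd_of_le_one hvert hdeg (by omega) (hc j hj).1.2
    · exact dvd_of_dvd_of_le_one hvert hdeg (by omega) hdvd

theorem OneSingularShape.singularPoints_eq {k : Type*} [Field k] [IsAlgClosed k] (hD : 0 < D)
    (hinj : Function.Injective b)
    (hvert : ∀ i : Fin (d + 1), b (Fin.castLE hdn i) = Pi.single i D)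
    (hdeg : ∀ l, ∑ i, b l i = D) (h : OneSingularShape D b)
    (hd : 2 ≤ d ∨ ∀ g : ℕ, (∀ l i, g ∣ b l i) → g = 1) :
    singularPoints k b = {coordPoint k 0} := by
  refine Set.eq_singleton_iff_unique_mem.2 ⟨?_, fun P hP => ?_⟩
  · exact (coordPoint_mem_singularPoints_iff k hD hinj hvert hdeg 0).2
      (h.not_smoothChart_zero hD hvert hdeg hd)
  · refine eq_coordPoint_of_mem_zeroLocus hdn hD hinj hvert hdeg hP.1 (j := 0) fun i hi => ?_
    by_contra hPi
    exact hP.2 ((h.smoothChart hi).isRegularLocalRing hD hvert hdeg hP.1 hPi)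

/-- If all vertices other than the vertex `0` are smooth and the vertex `0` is not, then `B` has the
shape of a simplicial variety with one singular point. -/
theorem oneSingularShape_of_smoothChart (hD : 0 < D)
    (hvert : ∀ i : Fin (d + 1), b (Fin.castLE hdn i) = Pi.single i D)
    (hgcd : ∀ g : ℕ, (∀ l i, g ∣ b l i) → g = 1)
    (hsmooth : ∀ j : Fin (d + 1), j ≠ 0 → SmoothChart D b j) (hsing : ¬ SmoothChart D b 0) :
    OneSingularShape D b := by
  have hd : ∃ j : Fin (d + 1), j ≠ 0 := by
    by_contra! h
    exact hsing ⟨0, fun i hi => absurd (h i) hi⟩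
  obtain ⟨j₀, hj₀⟩ := hd
  choose! c hc using hsmooth
  -- The generator along the edge from `j'` to `i` has `i`-th entry `c j' i`.
  have hdvd_right : ∀ j j' i : Fin (d + 1), j ≠ 0 → j' ≠ 0 → i ≠ j → i ≠ j' →
      c j i ∣ c j' i := by
    intro j j' i hj hj' hij hij'
    obtain ⟨l, hl⟩ := (hc j' hj' i hij').2
    have := (hc j hj i hij).1.2 l
    rw [hl] at this
    simpa [hij'] using this
  have hdvdD : ∀ {g : ℕ} {i : Fin (d + 1)}, (∀ l, g ∣ b l i) → g ∣ D := by
    intro g i hg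
    have := hg (Fin.castLE hdn i)
    rwa [hvert, Pi.single_eq_same] at this
  refine ⟨c j₀ 0, (hc j₀ hj₀ 0 hj₀.symm).1.1, hdvdD (hc j₀ hj₀ 0 hj₀.symm).1.2,
    (hc j₀ hj₀ 0 hj₀.symm).1.2, ?_, ?_, ?_⟩
  · intro i j hi hj
    by_cases hij : i = j
    · subst hij
      refine ⟨Fin.castLE hdn i, ?_⟩
      rw [hvert, ← Pi.single_add, Nat.sub_add_cancel hD]
    · have h1 : c i j = 1 := by
        -- For `m ≠ j`, the edge vector from `j` to `m` has `j`-th entry `D - c j m`. So `c i j`,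
        -- which divides this entry and `D`, divides `c j m`, hence all the `b l m`.
        refine hgcd _ fun l m => ?_
        have hg := (hc i hi j (Ne.symm hij)).1.2
        by_cases hm : m = j
        · exact hm ▸ hg l
        have hcm := (hc j hj m hm).1.2
        refine Dvd.dvd.trans ?_ (hcm l)
        obtain ⟨l', hl'⟩ := (hc j hj m hm).2
        have h2 := hg l'
        rw [hl'] at h2
        simp only [Pi.add_apply, Pi.single_eq_of_ne (Ne.symm hm), Pi.single_eq_same,
          zero_add] at h2
        have h3 := Nat.dvd_sub (hdvdD hg) h2
        rwa [Nat.sub_sub_self (Nat.le_of_dvd hD (hdvdD hcm))] at h3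
      have := (hc i hi j (Ne.symm hij)).2
      rwa [h1, add_comm (Pi.single _ _)] at this
  · intro j hj
    have he : c j 0 = c j₀ 0 := Nat.dvd_antisymm
      (hdvd_right j j₀ 0 hj hj₀ hj.symm hj₀.symm) (hdvd_right j₀ j 0 hj₀ hj hj₀.symm hj.symm)
    rw [← he]
    exact (hc j hj 0 hj.symm).2
  · intro _
    by_contra! h
    -- If every `(D-1)ε_0 + ε_j` were in `B`, the chart of `0` would be smooth with all steps `1`.
    refine hsing ⟨fun _ => 1, fun i hi => ⟨⟨one_pos, fun _ => one_dvd _⟩, ?_⟩⟩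
    rw [add_comm (Pi.single _ _)]
    exact h i hi

end OneSingular

end

end ToricSing

theorem mainTheorem9 {k : Type*} [Field k] [IsAlgClosed k] {n d : ℕ} (hdn : d + 1 ≤ n + 1)
    (D : ℕ) (hD : 0 < D) (b : Fin (n + 1) → Fin (d + 1) → ℕ) (hinj : Function.Injective b)
    (hvert : ∀ i : Fin (d + 1), b (Fin.castLE hdn i) = Pi.single i D)
    (hdeg : ∀ l, ∑ i, b l i = D) :
    (∀ P, ToricSing.singularPoints k b = {P} →
      ∃ i : Fin (d + 1), P = ToricSing.coordPoint k (Fin.castLE hdn i)) ∧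
    ((∀ g : ℕ, (∀ l i, g ∣ b l i) → g = 1) →
      (ToricSing.singularPoints k b = {ToricSing.coordPoint k 0} ↔
        ToricSing.OneSingularShape D b)) ∧
    (2 ≤ d → ToricSing.OneSingularShape D b →
      ToricSing.singularPoints k b = {ToricSing.coordPoint k 0}) := by
  refine ⟨fun P hP => ToricSing.exists_eq_coordPoint_of_singularPoints_eq_singleton hdn hD hinj
    hvert hdeg hP, fun hgcd => ⟨fun h => ?_, fun h => ?_⟩, fun hd h =>
    h.singularPoints_eq hD hinj hvert hdeg (Or.inl hd)⟩
  · have key := ToricSing.coordPoint_mem_singularPoints_iff k hD hinj hvert hdeg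
    refine ToricSing.oneSingularShape_of_smoothChart hD hvert hgcd (fun j hj => ?_) ?_
    · rw [← not_not (a := ToricSing.SmoothChart D b j), ← key, h, Set.mem_singleton_iff]
      exact fun h0 => hj (Fin.castLE_injective hdn (ToricSing.coordPoint_injective k h0))
    · rw [← key, h]
      rfl
  · exact h.singularPoints_eq hD hinj hvert hdeg (Or.inr hgcd)
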